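/- Conventions. A diffeological space is a set $X$ with a family of plots $U\to X$ ($U\subseteq\mathbb R^n$ open) that contains the constant maps, is closed under smooth reparametrization and satisfies the sheaf condition; smooth maps send plots to plots, and a subset is $D$-open if its preimage under every plot is open. Products, subsets and quotients carry the product, sub- and quotient diffeologies. A diffeological vector space $V$ is a real vector space with a diffeology for which addition and scalar multiplication are smooth. $\mathrm{GL}(V)$ is the group of linear diffeomorphisms $V\to V$; $p:U\to\mathrm{GL}(V)$ is a plot iff $(u,x)\mapsto p(u)(x)$ and $(u,x)\mapsto p(u)^{-1}(x)$ are smooth. Let $G$ be a diffeological group. Let $\pi:E\to B$ be a smooth map with a smooth right $G$-action on $E$ satisfying $\pi(x\cdot g)=\pi(x)$. It is trivial if there is a $G$-equivariant diffeomorphism $E\to B\times G$ over $B$, and locally trivial if $B$ has a $D$-open cover over each member of which it is trivial. It is a principal $G$-bundle if its pullback along every plot of $B$ is locally trivial. Isomorphisms of principal $G$-bundles over $B$ are $G$-equivariant diffeomorphisms over $B$. A diffeological vector space over $B$ is a smooth map $\pi:E\to B$ with a real vector space structure on each fiber such that addition $E\times_BE\to E$, scalar multiplication $\mathbb R\times E\to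 E$ and the zero section $B\to E$ are smooth. It is trivial of fiber type $V$ if there is a diffeomorphism $E\to B\times V$ over $B$ that is linear on each fiber; local triviality is defined as above. It is a vector bundle of fiber type $V$ if its pullback along every plot of $B$ is locally trivial of fiber type $V$. Isomorphisms over $B$ are diffeomorphisms over $B$ that are linear on each fiber. A principal bundle (resp. vector bundle) over $B$ is $D$-numerable if there is a smooth partition of unity $\{\mu_i\}$ on $B$ (smooth, nonnegative, with locally finite supports, and sum $1$), subordinate to a $D$-open cover $\{B_i\}$ (that is, $\operatorname{supp}\mu_i\subseteq B_i$, where $\operatorname{supp}\mu_i$ is the $D$-closure of $\{\mu_i>0\}$), such that the bundle is trivial over each $B_i$. Write $\mathrm{Prin}_G(B)\supseteq\mathrm{Prin}^D_G(B)$ and $\mathrm{VB}_V(B)\supseteq\mathrm{VB}^D_V(B)$ for the sets of isomorphism classes of all, respectively $D$-numerable, principal $G$-bundles and vector bundles of fiber type $V$ over $B$. They are contravariant functors of the diffeological space $B$ under pullback along smooth maps. Theorem. Let $V$ be a diffeological vector space. There is an isomorphism of functors of $B$, $$\mathrm{assoc}:\mathrm{Prin}_{\mathrm{GL}(V)}(B)\to\mathrm{VB}_V(B),$$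 which sends the class of a principal $\mathrm{GL}(V)$-bundle $E\to B$ to the class of the associated vector bundle $E\times_{\mathrm{GL}(V)}V=(E\times V)/\big((y,v)\sim(y\cdot g,g^{-1}v)\big)\to B$, with $v\mapsto[y,v]$ linear onto the fiber for every $y\in E$. Its inverse sends the class of a vector bundle $\pi:E\to B$ of fiber type $V$ to the class of the frame bundle $s:E''=\coprod_{b\in B}\mathrm{Isom}(\pi^{-1}(b),V)\to B$, where $\mathrm{Isom}$ denotes linear diffeomorphisms, with action $f\cdot g=g^{-1}\circ f$. Here $p:U\to E''$ is a plot iff $s\circ p$, the map $\{(u,y)\in U\times E: s(p(u))=\pi(y)\}\to V$, $(u,y)\mapsto p(u)(y)$, and the map $U\times V\to E$, $(u,x)\mapsto p(u)^{-1}(x)$, are smooth. (In particular, the associated bundle is a vector bundle of fiber type $V$ and the frame bundle is a principal $\mathrm{GL}(V)$-bundle.) Moreover, $\mathrm{assoc}$ and its inverse restrict to mutually inverse isomorphisms of functors $\mathrm{Prin}^D_{\mathrm{GL}(V)}(B)\cong\mathrm{VB}^D_V(B)$. -/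

import Mathlib

open Diffeology CategoryTheory Opposite Topology

universe u v w w' w'' e e' e''

namespace DiffBundle

/-! ### Basic constructions of diffeologies -/

/-- The Cartesian space `ℝⁿ`, with its standard diffeology. -/
abbrev Cart (n : ℕ) : Type := EuclideanSpace ℝ (Fin n)

/-- The diffeology on `X` pulled back along `f : X → Y`: `p` is a plot iff `f ∘ p` is one. -/
@[reducible] def inducedDiffeology {X : Type u} {Y : Type v} [DiffeologicalSpace Y] (f : X → Y) :
    DiffeologicalSpace X where
  plots n := {p | IsPlot (f ∘ p)}
  constant_plots x := isPlot_const (x := f x)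
  plot_reparam hp hf := isPlot_reparam hp hf
  locality {n p} h := by
    refine DiffeologicalSpace.locality (p := f ∘ p) fun x => ?_
    obtain ⟨U, hU, hx, h'⟩ := h x
    exact ⟨U, hU, hx, fun hf hs => h' hf hs⟩

/-- The sub-diffeology. -/
instance instSubtype {X : Type u} [DiffeologicalSpace X] (P : X → Prop) :
    DiffeologicalSpace {x // P x} :=
  inducedDiffeology Subtype.val

/-- The product diffeology. -/
instance instProd {X : Type u} {Y : Type v} [DiffeologicalSpace X] [DiffeologicalSpace Y] :
    DiffeologicalSpace (X × Y) where
  plots n := {p | IsPlot (fun t => (p t).1) ∧ IsPlot (fun t => (p t).2)}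
  constant_plots x := ⟨isPlot_const, isPlot_const⟩
  plot_reparam hp hf := ⟨isPlot_reparam hp.1 hf, isPlot_reparam hp.2 hf⟩
  locality {n p} h := by
    constructor
    · refine DiffeologicalSpace.locality (p := fun t => (p t).1) fun x => ?_
      obtain ⟨U, hU, hx, h'⟩ := h x
      exact ⟨U, hU, hx, fun hf hs => (h' hf hs).1⟩
    · refine DiffeologicalSpace.locality (p := fun t => (p t).2) fun x => ?_
      obtain ⟨U, hU, hx, h'⟩ := h x
      exact ⟨U, hU, hx, fun hf hs => (h' hf hs).2⟩

section Smooth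

variable {X : Type u} {Y : Type v} {Z : Type w}
  [DiffeologicalSpace X] [DiffeologicalSpace Y] [DiffeologicalSpace Z]

lemma dsmooth_val (P : X → Prop) : DSmooth (Subtype.val : {x // P x} → X) :=
  fun _ _ hp => hp

lemma dsmooth_fst : DSmooth (Prod.fst : X × Y → X) := fun _ _ hp => hp.1

lemma dsmooth_snd : DSmooth (Prod.snd : X × Y → Y) := fun _ _ hp => hp.2

lemma dsmooth_mk {f : X → Y} {g : X → Z} (hf : DSmooth f) (hg : DSmooth g) :
    DSmooth (fun x => (f x, g x)) :=
  fun n p hp => ⟨hf n p hp, hg n p hp⟩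

lemma dsmooth_subtype {P : Y → Prop} {f : X → {y // P y}} (hf : DSmooth (fun x => (f x).1)) :
    DSmooth f :=
  fun n p hp => hf n p hp

end Smooth

/-- The quotient diffeology: the plots are the maps which locally lift to smooth maps into `X`. -/
instance instQuotient {X : Type u} [DiffeologicalSpace X] (s : Setoid X) :
    DiffeologicalSpace (Quotient s) where
  plots n := {p | ∀ x : Cart n, ∃ U : Set (Cart n), IsOpen U ∧ x ∈ U ∧
    ∃ q : U → X, DSmooth q ∧ ∀ y : U, Quotient.mk s (q y) = p y}
  constant_plots z := fun x => by
    obtain ⟨a, rfl⟩ := Quotient.exists_rep z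
    exact ⟨Set.univ, isOpen_univ, trivial, fun _ => a, dSmooth_const, fun _ => rfl⟩
  plot_reparam {n m p f} hp hf := fun x => by
    obtain ⟨U, hU, hx, q, hq, hqp⟩ := hp (f x)
    refine ⟨f ⁻¹' U, hU.preimage hf.continuous, hx, fun y => q ⟨f y.1, y.2⟩, ?_, fun y => hqp _⟩
    refine hq.comp (g := q) (f := fun y : f ⁻¹' U => (⟨f y.1, y.2⟩ : U)) ?_
    exact dsmooth_subtype (hf.dSmooth.comp (dsmooth_val _))
  locality {n p} h := fun x => by
    obtain ⟨U, hU, hx, h'⟩ := h x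
    obtain ⟨ε, hε, hεU⟩ := Metric.isOpen_iff.mp hU x hx
    set φ := OpenPartialHomeomorph.univBall x ε with hφ
    have htgt : φ.target = Metric.ball x ε := OpenPartialHomeomorph.univBall_target x hε
    have hsrc : ∀ y, φ y ∈ Metric.ball x ε := fun y => by
      have := φ.map_source (x := y) (by simp [hφ])
      rwa [hφ, OpenPartialHomeomorph.univBall_target x hε] at this
    have hpl := h' (m := n) (f := φ) (fun y => hεU (hsrc y))
      OpenPartialHomeomorph.contDiff_univBall
    obtain ⟨W, hW, hxW, q, hq, hqp⟩ := hpl (φ.symm x)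
    have hcd : ContDiffOn ℝ (⊤ : ℕ∞) φ.symm (Metric.ball x ε) :=
      OpenPartialHomeomorph.contDiffOn_univBall_symm
    refine ⟨Metric.ball x ε ∩ φ.symm ⁻¹' W,
      hcd.continuousOn.isOpen_inter_preimage Metric.isOpen_ball hW,
      ⟨Metric.mem_ball_self hε, hxW⟩, fun y => q ⟨φ.symm y.1, y.2.2⟩, ?_, fun y => ?_⟩
    · refine hq.comp (g := q)
        (f := fun y : (Metric.ball x ε ∩ φ.symm ⁻¹' W : Set (Cart n)) =>
          (⟨φ.symm y.1, y.2.2⟩ : W)) (dsmooth_subtype fun m r hr => ?_)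
      refine ContDiff.isPlot ?_
      have hr' : ContDiff ℝ (⊤ : ℕ∞) (fun t => (r t).1) := IsPlot.contDiff (X := Cart n) hr
      exact hcd.comp_contDiff hr' fun t => (r t).2.1
    · rw [hqp]
      change p (φ (φ.symm y.1)) = p y.1
      rw [φ.right_inv (by rw [htgt]; exact y.2.1)]

/-- Diffeomorphisms between diffeological spaces. -/
structure DDiffeo (X : Type u) (Y : Type v) [DiffeologicalSpace X] [DiffeologicalSpace Y]
    extends X ≃ Y where
  smooth_toFun : DSmooth toFun
  smooth_invFun : DSmooth invFun

namespace DDiffeo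

variable {X : Type u} {Y : Type v} {Z : Type w}
  [DiffeologicalSpace X] [DiffeologicalSpace Y] [DiffeologicalSpace Z]

instance : CoeFun (DDiffeo X Y) (fun _ => X → Y) := ⟨fun f => f.toFun⟩

lemma toEquiv_inj {f g : DDiffeo X Y} (h : f.toEquiv = g.toEquiv) : f = g := by
  cases f; cases g; cases h; rfl

def refl (X : Type u) [DiffeologicalSpace X] : DDiffeo X X := ⟨Equiv.refl X, dSmooth_id, dSmooth_id⟩

def symm (f : DDiffeo X Y) : DDiffeo Y X := ⟨f.toEquiv.symm, f.smooth_invFun, f.smooth_toFun⟩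

def trans (f : DDiffeo X Y) (g : DDiffeo Y Z) : DDiffeo X Z :=
  ⟨f.toEquiv.trans g.toEquiv, g.smooth_toFun.comp f.smooth_toFun,
    f.smooth_invFun.comp g.smooth_invFun⟩

/-- `Diff(X)` is a group under composition: `(f * g) x = f (g x)`. -/
instance : Group (DDiffeo X X) where
  one := refl X
  mul f g := g.trans f
  inv f := f.symm
  mul_assoc _ _ _ := rfl
  one_mul _ := rfl
  mul_one _ := rfl
  inv_mul_cancel f := toEquiv_inj (by
    change f.toEquiv.trans f.toEquiv.symm = _
    rw [Equiv.self_trans_symm]; rfl)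

/-- A parametrization `p` of `Diff(X)` is a plot iff both `(u, x) ↦ p(u)(x)` and
`(u, x) ↦ p(u)⁻¹(x)` are smooth. -/
instance : DiffeologicalSpace (DDiffeo X X) where
  plots n := {p | DSmooth (fun z : Cart n × X => p z.1 z.2) ∧
    DSmooth (fun z : Cart n × X => (p z.1).symm z.2)}
  constant_plots f := ⟨f.smooth_toFun.comp dsmooth_snd, f.smooth_invFun.comp dsmooth_snd⟩
  plot_reparam hp hf :=
    ⟨hp.1.comp (dsmooth_mk (hf.dSmooth.comp dsmooth_fst) dsmooth_snd),
     hp.2.comp (dsmooth_mk (hf.dSmooth.comp dsmooth_fst) dsmooth_snd)⟩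
  locality {n p} h := by
    constructor
    all_goals
      intro m q hq
      refine DiffeologicalSpace.locality fun s => ?_
      obtain ⟨U, hU, hs, h'⟩ := h (q s).1
      have hq1 : ContDiff ℝ (⊤ : ℕ∞) (fun t => (q t).1) := IsPlot.contDiff (X := Cart n) hq.1
      refine ⟨(fun t => (q t).1) ⁻¹' U, hU.preimage hq1.continuous, hs, fun {k g} hg hgs => ?_⟩
      have key := h' (m := k) (f := fun r => (q (g r)).1) hg (hq1.comp hgs)
    · exact key.1 k (fun r => (r, (q (g r)).2)) ⟨isPlot_id, isPlot_reparam hq.2 hgs⟩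
    · exact key.2 k (fun r => (r, (q (g r)).2)) ⟨isPlot_id, isPlot_reparam hq.2 hgs⟩

end DDiffeo

/-! ### Diffeological groups, diffeological vector spaces, `GL(V)` -/

/-- A diffeological group: the group operations are smooth. -/
class DiffeologicalGroup (G : Type u) [Group G] [DiffeologicalSpace G] : Prop where
  smooth_mul : DSmooth (fun p : G × G => p.1 * p.2)
  smooth_inv : DSmooth (fun g : G => g⁻¹)

instance {X : Type u} [DiffeologicalSpace X] : DiffeologicalGroup (DDiffeo X X) where
  smooth_mul _ _ hp :=
    ⟨hp.1.1.comp (dsmooth_mk dsmooth_fst hp.2.1), hp.2.2.comp (dsmooth_mk dsmooth_fst hp.1.2)⟩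
  smooth_inv _ _ hp := ⟨hp.2, hp.1⟩

instance {G : Type u} [Group G] [DiffeologicalSpace G] [DiffeologicalGroup G] (H : Subgroup G) :
    DiffeologicalGroup H where
  smooth_mul := dsmooth_subtype (DiffeologicalGroup.smooth_mul.comp
    (dsmooth_mk ((dsmooth_val _).comp dsmooth_fst) ((dsmooth_val _).comp dsmooth_snd)))
  smooth_inv := dsmooth_subtype (DiffeologicalGroup.smooth_inv.comp (dsmooth_val _))

/-- A (real) diffeological vector space: addition and scalar multiplication are smooth. -/
class DiffeologicalVectorSpace (V : Type u) [AddCommGroup V] [Module ℝ V]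
    [DiffeologicalSpace V] : Prop where
  smooth_add : DSmooth (fun p : V × V => p.1 + p.2)
  smooth_smul : DSmooth (fun p : ℝ × V => p.1 • p.2)

lemma isLinearMap_symm {M : Type u} {N : Type v} [AddCommGroup M] [Module ℝ M] [AddCommGroup N]
    [Module ℝ N] (h : M ≃ N) (hl : IsLinearMap ℝ h) : IsLinearMap ℝ h.symm where
  map_add x y := h.injective (by simp [hl.map_add])
  map_smul c x := h.injective (by simp [hl.map_smul])

/-- `GL(V)`: the subgroup of `Diff(V)` of linear isomorphisms, with the sub-diffeology. -/
def GLin (V : Type u) [AddCommGroup V] [Module ℝ V] [DiffeologicalSpace V] :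
    Subgroup (DDiffeo V V) where
  carrier := {f | IsLinearMap ℝ f}
  mul_mem' {f _} hf hg :=
    { map_add := fun x y => (congrArg f (hg.map_add x y)).trans (hf.map_add _ _)
      map_smul := fun c x => (congrArg f (hg.map_smul c x)).trans (hf.map_smul _ _) }
  one_mem' := { map_add := fun _ _ => rfl, map_smul := fun _ _ => rfl }
  inv_mem' {f} hf := isLinearMap_symm f.toEquiv hf

/-! ### Smooth partitions of unity -/

/-- The support of `μ`: the closure of `μ⁻¹((0, ∞))` in the `D`-topology. -/
def dsupport {X : Type u} [DiffeologicalSpace X] (μ : X → ℝ) : Set X :=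
  @closure X dTopology {x | 0 < μ x}

structure IsSmoothPartitionOfUnity {X : Type u} [DiffeologicalSpace X] {I : Type v}
    (μ : I → X → ℝ) : Prop where
  smooth : ∀ i, DSmooth (μ i)
  nonneg : ∀ i x, 0 ≤ μ i x
  locallyFinite : @LocallyFinite I X dTopology (fun i => dsupport (μ i))
  sum_eq_one : ∀ x, ∑ᶠ i, μ i x = 1

/-- For a predicate `T` (below, `T U` means "trivial over `U`"): there is a smooth partition of unity subordinate to a `D`-open cover by sets
satisfying `T`. -/
def NumerablyTrivial {B : Type u} [DiffeologicalSpace B] (T : Set B → Prop) : Prop :=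
  ∃ (I : Type u) (U : I → Set B) (μ : I → B → ℝ),
    (∀ i, IsOpen[dTopology] (U i)) ∧ (⋃ i, U i) = Set.univ ∧
    IsSmoothPartitionOfUnity μ ∧ (∀ i, dsupport (μ i) ⊆ U i) ∧ ∀ i, T (U i)

/-- There is a `D`-open cover by sets satisfying `T`. -/
def HasOpenCover {B : Type u} [DiffeologicalSpace B] (T : Set B → Prop) : Prop :=
  ∃ 𝒰 : Set (Set B), (∀ U ∈ 𝒰, IsOpen[dTopology] U) ∧ ⋃₀ 𝒰 = Set.univ ∧ ∀ U ∈ 𝒰, T U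

/-- The fiber `π⁻¹(b)`, with the sub-diffeology. -/
abbrev Fiber {E : Type e} {B : Type w} (π : E → B) (b : B) : Type e := {x : E // π x = b}

/-- The total space `f^*(E)` of a pullback, with the sub-diffeology of `B' × E`. -/
abbrev PullbackTotal {E : Type e} {B : Type w} {B' : Type w'} (f : B' → B) (π : E → B) :
    Type (max w' e) :=
  {z : B' × E // f z.1 = π z.2}

/-! ### Principal bundles -/

/-- A smooth map `π : E → B` together with a smooth right action of `G` on `E` such that
`π (x · g) = π x`. -/
structure GSpace (G : Type v) [Group G] [DiffeologicalSpace G]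
    (B : Type w) [DiffeologicalSpace B] where
  E : Type e
  [diff : DiffeologicalSpace E]
  proj : E → B
  smooth_proj : DSmooth proj
  act : E → G → E
  smooth_act : DSmooth (fun z : E × G => act z.1 z.2)
  act_one : ∀ x, act x 1 = x
  act_mul : ∀ x g h, act x (g * h) = act (act x g) h
  proj_act : ∀ x g, proj (act x g) = proj x

attribute [instance] GSpace.diff

namespace GSpace

variable {G : Type v} [Group G] [DiffeologicalSpace G]
variable {B : Type w} [DiffeologicalSpace B] {B' : Type w'} [DiffeologicalSpace B']
  {B'' : Type w''} [DiffeologicalSpace B'']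

/-- There is a `G`-equivariant diffeomorphism over `B`. -/
def Isomorphic (P : GSpace.{v, w, e} G B) (Q : GSpace.{v, w, e'} G B) : Prop :=
  ∃ h : DDiffeo P.E Q.E, (∀ x, Q.proj (h x) = P.proj x) ∧
    ∀ x g, h (P.act x g) = Q.act (h x) g

/-- There is a `G`-equivariant diffeomorphism to `B × G` over `B`, where
`(b, g) · g' = (b, g g')`. -/
def IsTrivial (P : GSpace.{v, w, e} G B) : Prop :=
  ∃ h : DDiffeo P.E (B × G), (∀ x, (h x).1 = P.proj x) ∧
    ∀ x g, h (P.act x g) = ((h x).1, (h x).2 * g)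

/-- The pullback along a smooth map. -/
def pullback (f : B' → B) (hf : DSmooth f) (P : GSpace.{v, w, e} G B) :
    GSpace.{v, w', max w' e} G B' where
  E := PullbackTotal f P.proj
  proj z := z.1.1
  smooth_proj := dsmooth_fst.comp (dsmooth_val _)
  act z g := ⟨(z.1.1, P.act z.1.2 g), z.2.trans (P.proj_act _ _).symm⟩
  smooth_act := dsmooth_subtype (dsmooth_mk
    (dsmooth_fst.comp ((dsmooth_val _).comp dsmooth_fst))
    (P.smooth_act.comp (dsmooth_mk
      (dsmooth_snd.comp ((dsmooth_val _).comp dsmooth_fst)) dsmooth_snd)))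
  act_one _ := Subtype.ext (Prod.ext rfl (P.act_one _))
  act_mul _ _ _ := Subtype.ext (Prod.ext rfl (P.act_mul _ _ _))
  proj_act _ _ := rfl

/-- The restriction of `π` to `π⁻¹(U) → U`, as the pullback along the inclusion of `U`. -/
def restrict (P : GSpace.{v, w, e} G B) (U : Set B) : GSpace.{v, w, max w e} G U :=
  P.pullback (Subtype.val : U → B) (dsmooth_val _)

def IsLocallyTrivial (P : GSpace.{v, w, e} G B) : Prop :=
  HasOpenCover fun U => (P.restrict U).IsTrivial

/-- `P` is a (diffeological) principal `G`-bundle: its pullback along every plot `p : U → B`, where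
`U` is open in some `ℝⁿ`, is locally trivial. -/
def IsPrincipal (P : GSpace.{v, w, e} G B) : Prop :=
  ∀ (n : ℕ) (U : Set (Cart n)) (_ : IsOpen U) (p : U → B) (hp : DSmooth p),
    (P.pullback p hp).IsLocallyTrivial

/-- The additional condition for a principal bundle to be a `D`-numerable principal bundle. -/
def IsNumerable (P : GSpace.{v, w, e} G B) : Prop :=
  NumerablyTrivial fun U => (P.restrict U).IsTrivial

lemma Isomorphic.refl (P : GSpace.{v, w, e} G B) : P.Isomorphic P :=
  ⟨DDiffeo.refl _, fun _ => rfl, fun _ _ => rfl⟩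

lemma Isomorphic.symm {P : GSpace.{v, w, e} G B} {Q : GSpace.{v, w, e'} G B}
    (h : P.Isomorphic Q) : Q.Isomorphic P := by
  obtain ⟨h, h1, h2⟩ := h
  have hr : ∀ y, h (h.symm y) = y := h.toEquiv.apply_symm_apply
  refine ⟨h.symm, fun x => ?_, fun x g => h.toEquiv.injective ?_⟩
  · rw [← h1, hr]
  · change h (h.symm _) = h _
    rw [hr, h2, hr]

lemma Isomorphic.trans {P : GSpace.{v, w, e} G B} {Q : GSpace.{v, w, e'} G B}
    {R : GSpace.{v, w, e''} G B} (h : P.Isomorphic Q) (k : Q.Isomorphic R) : P.Isomorphic R := by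
  obtain ⟨h, h1, h2⟩ := h
  obtain ⟨k, k1, k2⟩ := k
  exact ⟨h.trans k, fun x => (k1 _).trans (h1 _), fun x g => (congrArg k (h2 x g)).trans (k2 _ _)⟩

lemma IsTrivial.of_iso {P : GSpace.{v, w, e} G B} {Q : GSpace.{v, w, e'} G B}
    (h : P.Isomorphic Q) (hQ : Q.IsTrivial) : P.IsTrivial := by
  obtain ⟨h, h1, h2⟩ := h
  obtain ⟨k, k1, k2⟩ := hQ
  exact ⟨h.trans k, fun x => (k1 _).trans (h1 _), fun x g => (congrArg k (h2 x g)).trans (k2 _ _)⟩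

lemma Isomorphic.pullback {P : GSpace.{v, w, e} G B} {Q : GSpace.{v, w, e'} G B}
    (h : P.Isomorphic Q) (f : B' → B) (hf : DSmooth f) :
    (P.pullback f hf).Isomorphic (Q.pullback f hf) := by
  have hs := h.symm
  obtain ⟨h, h1, h2⟩ := h
  have hr : ∀ y, h (h.symm y) = y := h.toEquiv.apply_symm_apply
  have hl : ∀ y, h.symm (h y) = y := h.toEquiv.symm_apply_apply
  refine ⟨⟨⟨fun z => ⟨(z.1.1, h z.1.2), z.2.trans (h1 _).symm⟩,
    fun z => ⟨(z.1.1, h.symm z.1.2), z.2.trans (by rw [← h1, hr])⟩,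
    fun z => Subtype.ext (Prod.ext rfl (hl _)), fun z => Subtype.ext (Prod.ext rfl (hr _))⟩,
    dsmooth_subtype ?_, dsmooth_subtype ?_⟩, fun _ => rfl,
    fun z g => Subtype.ext (Prod.ext rfl (h2 _ _))⟩
  · exact dsmooth_mk (dsmooth_fst.comp (dsmooth_val _))
      (h.smooth_toFun.comp (dsmooth_snd.comp (dsmooth_val _)))
  · exact dsmooth_mk (dsmooth_fst.comp (dsmooth_val _))
      (h.smooth_invFun.comp (dsmooth_snd.comp (dsmooth_val _)))

lemma pullback_id (P : GSpace.{v, w, e} G B) : (P.pullback id dSmooth_id).Isomorphic P := by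
  refine ⟨⟨⟨fun z => z.1.2, fun x => ⟨(P.proj x, x), rfl⟩,
    fun z => Subtype.ext (Prod.ext z.2.symm rfl), fun _ => rfl⟩,
    dsmooth_snd.comp (dsmooth_val _), dsmooth_subtype (dsmooth_mk P.smooth_proj dSmooth_id)⟩,
    fun z => z.2.symm, fun _ _ => rfl⟩

lemma pullback_comp (P : GSpace.{v, w, e} G B) (f : B' → B) (hf : DSmooth f) (g : B'' → B')
    (hg : DSmooth g) :
    (P.pullback (f ∘ g) (hf.comp hg)).Isomorphic ((P.pullback f hf).pullback g hg) := by
  refine ⟨⟨⟨fun z => ⟨(z.1.1, ⟨(g z.1.1, z.1.2), z.2⟩), rfl⟩,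
    fun z => ⟨(z.1.1, z.1.2.1.2), (congrArg f z.2).trans z.1.2.2⟩, fun _ => rfl,
    fun z => Subtype.ext (Prod.ext rfl (Subtype.ext (Prod.ext z.2 rfl)))⟩,
    dsmooth_subtype (dsmooth_mk (dsmooth_fst.comp (dsmooth_val _)) (dsmooth_subtype
      (dsmooth_mk (hg.comp (dsmooth_fst.comp (dsmooth_val _)))
        (dsmooth_snd.comp (dsmooth_val _))))),
    dsmooth_subtype (dsmooth_mk (dsmooth_fst.comp (dsmooth_val _))
      (dsmooth_snd.comp ((dsmooth_val _).comp (dsmooth_snd.comp (dsmooth_val _)))))⟩,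
    fun _ => rfl, fun _ _ => rfl⟩

lemma IsTrivial.pullback {P : GSpace.{v, w, e} G B} (h : P.IsTrivial) (f : B' → B)
    (hf : DSmooth f) : (P.pullback f hf).IsTrivial := by
  obtain ⟨h, h1, h2⟩ := h
  have hr : ∀ y, h (h.symm y) = y := h.toEquiv.apply_symm_apply
  have hl : ∀ y, h.symm (h y) = y := h.toEquiv.symm_apply_apply
  refine ⟨⟨⟨fun z => (z.1.1, (h z.1.2).2),
    fun y => ⟨(y.1, h.symm (f y.1, y.2)), by rw [← h1, hr]⟩,
    fun z => Subtype.ext (Prod.ext rfl ?_), fun y => Prod.ext rfl ?_⟩, ?_, dsmooth_subtype ?_⟩,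
    fun _ => rfl, fun z g => Prod.ext rfl ?_⟩
  · change h.symm (f z.1.1, (h z.1.2).2) = z.1.2
    rw [z.2, ← h1, Prod.mk.eta, hl]
  · change (h (h.symm (f y.1, y.2))).2 = y.2
    rw [hr]
  · exact dsmooth_mk (dsmooth_fst.comp (dsmooth_val _))
      (dsmooth_snd.comp (h.smooth_toFun.comp (dsmooth_snd.comp (dsmooth_val _))))
  · exact dsmooth_mk dsmooth_fst
      (h.smooth_invFun.comp (dsmooth_mk (hf.comp dsmooth_fst) dsmooth_snd))
  · exact (congrArg Prod.snd (h2 z.1.2 g) :)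

lemma IsLocallyTrivial.of_iso {P : GSpace.{v, w, e} G B} {Q : GSpace.{v, w, e'} G B}
    (h : P.Isomorphic Q) (hQ : Q.IsLocallyTrivial) : P.IsLocallyTrivial := by
  obtain ⟨𝒰, h1, h2, h3⟩ := hQ
  exact ⟨𝒰, h1, h2, fun U hU => (h3 U hU).of_iso (h.pullback _ (dsmooth_val _))⟩

lemma IsPrincipal.pullback {P : GSpace.{v, w, e} G B} (h : P.IsPrincipal) (f : B' → B)
    (hf : DSmooth f) : (P.pullback f hf).IsPrincipal :=
  fun n U hU p hp => (h n U hU (f ∘ p) (hf.comp hp)).of_iso (P.pullback_comp f hf p hp).symm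

lemma restrict_pullback (P : GSpace.{v, w, e} G B) (f : B' → B) (hf : DSmooth f) (U : Set B)
    (h : (P.restrict U).IsTrivial) : ((P.pullback f hf).restrict (f ⁻¹' U)).IsTrivial := by
  have hr : DSmooth (fun x : f ⁻¹' U => (⟨f x.1, x.2⟩ : U)) :=
    dsmooth_subtype (hf.comp (dsmooth_val _))
  have h1 := P.pullback_comp f hf (Subtype.val : f ⁻¹' U → B') (dsmooth_val _)
  have h2 := P.pullback_comp (Subtype.val : U → B) (dsmooth_val _) _ hr
  exact (h.pullback _ hr).of_iso (h1.symm.trans h2)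

end GSpace

lemma NumerablyTrivial.pullback {B : Type u} [DiffeologicalSpace B] {B' : Type u}
    [DiffeologicalSpace B'] {T : Set B → Prop} {T' : Set B' → Prop} (h : NumerablyTrivial T)
    {f : B' → B} (hf : DSmooth f) (hT : ∀ U, T U → T' (f ⁻¹' U)) : NumerablyTrivial T' := by
  obtain ⟨I, U, μ, h1, h2, h3, h4, h5⟩ := h
  let tB : TopologicalSpace B := dTopology
  let tB' : TopologicalSpace B' := dTopology
  have hc : Continuous f := hf.continuous
  have hsub : ∀ i, dsupport (μ i ∘ f) ⊆ f ⁻¹' dsupport (μ i) := fun i =>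
    closure_minimal (fun x hx => subset_closure (show 0 < μ i (f x) from hx))
      (isClosed_closure.preimage hc)
  refine ⟨I, fun i => f ⁻¹' U i, fun i => μ i ∘ f, fun i => (h1 i).preimage hc, ?_,
    ⟨fun i => (h3.smooth i).comp hf, fun i x => h3.nonneg i _, ?_, fun x => h3.sum_eq_one _⟩,
    fun i => (hsub i).trans (Set.preimage_mono (h4 i)), fun i => hT _ (h5 i)⟩
  · rw [← Set.preimage_iUnion, h2, Set.preimage_univ]
  · exact (h3.locallyFinite.preimage_continuous hc).subset hsub

/-! ### Vector bundles -/

/-- A smooth map `π : E → B` together with a real vector space structure on each fiber. -/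
structure VectorFamily (B : Type w) [DiffeologicalSpace B] where
  E : Type e
  [diff : DiffeologicalSpace E]
  proj : E → B
  smooth_proj : DSmooth proj
  [addCommGroup : ∀ b, AddCommGroup (Fiber proj b)]
  [module : ∀ b, Module ℝ (Fiber proj b)]

attribute [instance] VectorFamily.diff VectorFamily.addCommGroup VectorFamily.module

/-- The fiber of `f^*(E)` over `b'` is the fiber of `E` over `f b'`. -/
def pullbackFiberEquiv {E : Type e} {B : Type w} {B' : Type w'} (f : B' → B) (π : E → B) (b' : B') :
    Fiber (fun z : PullbackTotal f π => z.1.1) b' ≃ Fiber π (f b') where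
  toFun z := ⟨z.1.1.2, z.1.2.symm.trans (congrArg f z.2)⟩
  invFun x := ⟨⟨(b', x.1), x.2.symm⟩, rfl⟩
  left_inv z := Subtype.ext (Subtype.ext (Prod.ext z.2.symm rfl))
  right_inv _ := rfl

namespace VectorFamily

variable {B : Type w} [DiffeologicalSpace B] {B' : Type w'} [DiffeologicalSpace B']
  {B'' : Type w''} [DiffeologicalSpace B'']

/-- `X` is a diffeological vector space over `B`: addition `E ×_B E → E`, scalar multiplication
`ℝ × E → E` and the zero section `B → E` are smooth. -/
structure IsDiffeologicalVectorSpace (X : VectorFamily.{w, e} B) : Prop where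
  smooth_add : DSmooth (fun z : {z : X.E × X.E // X.proj z.1 = X.proj z.2} =>
    ((⟨z.1.1, z.2⟩ + ⟨z.1.2, rfl⟩ : Fiber X.proj (X.proj z.1.2)) : X.E))
  smooth_smul : DSmooth (fun z : ℝ × X.E =>
    ((z.1 • ⟨z.2, rfl⟩ : Fiber X.proj (X.proj z.2)) : X.E))
  smooth_zero : DSmooth (fun b : B => ((0 : Fiber X.proj b) : X.E))

/-- There is a diffeomorphism over `B` which is linear on each fiber. -/
def Isomorphic (X : VectorFamily.{w, e} B) (Y : VectorFamily.{w, e'} B) : Prop :=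
  ∃ (h : DDiffeo X.E Y.E) (hp : ∀ x, Y.proj (h x) = X.proj x), ∀ b,
    IsLinearMap ℝ (fun x : Fiber X.proj b => (⟨h x.1, (hp x.1).trans x.2⟩ : Fiber Y.proj b))

/-- There is a diffeomorphism `E → B × V` over `B` which is linear on each fiber. -/
def IsTrivial (V : Type v) [AddCommGroup V] [Module ℝ V] [DiffeologicalSpace V]
    (X : VectorFamily.{w, e} B) : Prop :=
  ∃ h : DDiffeo X.E (B × V), (∀ x, (h x).1 = X.proj x) ∧
    ∀ b, IsLinearMap ℝ (fun x : Fiber X.proj b => (h x.1).2)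

/-- The pullback along a smooth map; the fiber over `b'` has the vector space structure
of the fiber over `f b'`. -/
def pullback (f : B' → B) (_ : DSmooth f) (X : VectorFamily.{w, e} B) :
    VectorFamily.{w', max w' e} B' where
  E := PullbackTotal f X.proj
  proj := fun z : PullbackTotal f X.proj => z.1.1
  smooth_proj := dsmooth_fst.comp (dsmooth_val _)
  addCommGroup b' := (pullbackFiberEquiv f X.proj b').addCommGroup
  module b' :=
    letI := (pullbackFiberEquiv f X.proj b').addCommGroup
    (pullbackFiberEquiv f X.proj b').module ℝ

/-- The restriction of `π` to `π⁻¹(U) → U`, as the pullback along the inclusion of `U`. -/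
def restrict (X : VectorFamily.{w, e} B) (U : Set B) : VectorFamily.{w, max w e} U :=
  X.pullback (Subtype.val : U → B) (dsmooth_val _)

section

variable (V : Type v) [AddCommGroup V] [Module ℝ V] [DiffeologicalSpace V]

def IsLocallyTrivial (X : VectorFamily.{w, e} B) : Prop :=
  HasOpenCover fun U => (X.restrict U).IsTrivial V

/-- `X` is a vector bundle of fiber type `V`: it is a diffeological vector space over `B` and its
pullback along every plot `p : U → B`, where `U` is open in some `ℝⁿ`, is locally trivial. -/
structure IsVectorBundle (X : VectorFamily.{w, e} B) : Prop where
  isDVS : X.IsDiffeologicalVectorSpace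
  locallyTrivial : ∀ (n : ℕ) (U : Set (Cart n)) (_ : IsOpen U) (p : U → B) (hp : DSmooth p),
    (X.pullback p hp).IsLocallyTrivial V

/-- The additional condition for a vector bundle to be `D`-numerable. -/
def IsNumerable (X : VectorFamily.{w, e} B) : Prop :=
  NumerablyTrivial fun U => (X.restrict U).IsTrivial V

end

lemma Isomorphic.refl (X : VectorFamily.{w, e} B) : X.Isomorphic X :=
  ⟨DDiffeo.refl _, fun _ => rfl, fun _ => ⟨fun _ _ => rfl, fun _ _ => rfl⟩⟩

lemma Isomorphic.symm {X : VectorFamily.{w, e} B} {Y : VectorFamily.{w, e'} B}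
    (h : X.Isomorphic Y) : Y.Isomorphic X := by
  obtain ⟨h, h1, h2⟩ := h
  have hr : ∀ y, h (h.symm y) = y := h.toEquiv.apply_symm_apply
  have hl : ∀ y, h.symm (h y) = y := h.toEquiv.symm_apply_apply
  have h1' : ∀ y, X.proj (h.symm y) = Y.proj y := fun y => by rw [← h1, hr]
  refine ⟨h.symm, h1', fun b => ?_⟩
  exact isLinearMap_symm (M := Fiber X.proj b) (N := Fiber Y.proj b)
    ⟨fun x => ⟨h x.1, (h1 x.1).trans x.2⟩, fun y => ⟨h.symm y.1, (h1' y.1).trans y.2⟩,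
      fun x => Subtype.ext (hl _), fun y => Subtype.ext (hr _)⟩ (h2 b)

lemma Isomorphic.trans {X : VectorFamily.{w, e} B} {Y : VectorFamily.{w, e'} B}
    {Z : VectorFamily.{w, e''} B} (h : X.Isomorphic Y) (k : Y.Isomorphic Z) :
    X.Isomorphic Z := by
  obtain ⟨h, h1, h2⟩ := h
  obtain ⟨k, k1, k2⟩ := k
  refine ⟨h.trans k, fun x => (k1 _).trans (h1 _), fun b => ?_⟩
  exact ((k2 b).mk' _ ∘ₗ (h2 b).mk' _).isLinear

lemma IsTrivial.of_iso {V : Type v} [AddCommGroup V] [Module ℝ V] [DiffeologicalSpace V]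
    {X : VectorFamily.{w, e} B} {Y : VectorFamily.{w, e'} B}
    (h : X.Isomorphic Y) (hY : Y.IsTrivial V) : X.IsTrivial V := by
  obtain ⟨h, h1, h2⟩ := h
  obtain ⟨k, k1, k2⟩ := hY
  refine ⟨h.trans k, fun x => (k1 _).trans (h1 _), fun b => ?_⟩
  exact ((k2 b).mk' _ ∘ₗ (h2 b).mk' _).isLinear

/-- The projection from the fiber of `f^*(E)` over `b'` to the fiber of `E` over `f b'`. -/
def pullbackFiber (f : B' → B) (hf : DSmooth f) (X : VectorFamily.{w, e} B) (b' : B') :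
    Fiber (X.pullback f hf).proj b' ≃ Fiber X.proj (f b') :=
  pullbackFiberEquiv f X.proj b'

lemma isLinearMap_pullbackFiber (f : B' → B) (hf : DSmooth f) (X : VectorFamily.{w, e} B)
    (b' : B') : IsLinearMap ℝ (pullbackFiber f hf X b') where
  map_add _ _ := rfl
  map_smul _ _ := rfl

lemma isLinearMap_pullbackFiber_symm (f : B' → B) (hf : DSmooth f) (X : VectorFamily.{w, e} B)
    (b' : B') : IsLinearMap ℝ (pullbackFiber f hf X b').symm :=
  isLinearMap_symm _ (isLinearMap_pullbackFiber f hf X b')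

lemma Isomorphic.pullback {X : VectorFamily.{w, e} B} {Y : VectorFamily.{w, e'} B}
    (h : X.Isomorphic Y) (f : B' → B) (hf : DSmooth f) :
    (X.pullback f hf).Isomorphic (Y.pullback f hf) := by
  obtain ⟨h, h1, h2⟩ := h
  have hr : ∀ y, h (h.symm y) = y := h.toEquiv.apply_symm_apply
  have hl : ∀ y, h.symm (h y) = y := h.toEquiv.symm_apply_apply
  refine ⟨⟨⟨fun z => ⟨(z.1.1, h z.1.2), z.2.trans (h1 _).symm⟩,
    fun z => ⟨(z.1.1, h.symm z.1.2), z.2.trans (by rw [← h1, hr])⟩,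
    fun z => Subtype.ext (Prod.ext rfl (hl _)), fun z => Subtype.ext (Prod.ext rfl (hr _))⟩,
    dsmooth_subtype ?_, dsmooth_subtype ?_⟩, fun _ => rfl, fun b' => ?_⟩
  · exact dsmooth_mk (dsmooth_fst.comp (dsmooth_val _))
      (h.smooth_toFun.comp (dsmooth_snd.comp (dsmooth_val _)))
  · exact dsmooth_mk (dsmooth_fst.comp (dsmooth_val _))
      (h.smooth_invFun.comp (dsmooth_snd.comp (dsmooth_val _)))
  · convert ((isLinearMap_pullbackFiber_symm f hf Y b').mk' _ ∘ₗ (h2 (f b')).mk' _ ∘ₗ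
      (isLinearMap_pullbackFiber f hf X b').mk' _).isLinear using 1
    funext z
    exact Subtype.ext (Subtype.ext (Prod.ext z.2 rfl))

lemma pullback_id (X : VectorFamily.{w, e} B) : (X.pullback id dSmooth_id).Isomorphic X :=
  ⟨⟨⟨fun z => z.1.2, fun x => ⟨(X.proj x, x), rfl⟩,
    fun z => Subtype.ext (Prod.ext z.2.symm rfl), fun _ => rfl⟩,
    dsmooth_snd.comp (dsmooth_val _), dsmooth_subtype (dsmooth_mk X.smooth_proj dSmooth_id)⟩,
    fun z => z.2.symm, fun b => isLinearMap_pullbackFiber id dSmooth_id X b⟩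

lemma pullback_comp (X : VectorFamily.{w, e} B) (f : B' → B) (hf : DSmooth f) (g : B'' → B')
    (hg : DSmooth g) :
    (X.pullback (f ∘ g) (hf.comp hg)).Isomorphic ((X.pullback f hf).pullback g hg) := by
  refine ⟨⟨⟨fun z => ⟨(z.1.1, ⟨(g z.1.1, z.1.2), z.2⟩), rfl⟩,
    fun z => ⟨(z.1.1, z.1.2.1.2), (congrArg f z.2).trans z.1.2.2⟩, fun _ => rfl,
    fun z => Subtype.ext (Prod.ext rfl (Subtype.ext (Prod.ext z.2 rfl)))⟩,
    dsmooth_subtype (dsmooth_mk (dsmooth_fst.comp (dsmooth_val _)) (dsmooth_subtype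
      (dsmooth_mk (hg.comp (dsmooth_fst.comp (dsmooth_val _)))
        (dsmooth_snd.comp (dsmooth_val _))))),
    dsmooth_subtype (dsmooth_mk (dsmooth_fst.comp (dsmooth_val _))
      (dsmooth_snd.comp ((dsmooth_val _).comp (dsmooth_snd.comp (dsmooth_val _)))))⟩,
    fun _ => rfl, fun b => ?_⟩
  convert ((isLinearMap_pullbackFiber_symm g hg (X.pullback f hf) b).mk' _ ∘ₗ
    (isLinearMap_pullbackFiber_symm f hf X (g b)).mk' _ ∘ₗ
    (isLinearMap_pullbackFiber (f ∘ g) (hf.comp hg) X b).mk' _).isLinear using 1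
  funext z
  obtain ⟨z, rfl⟩ := z
  rfl

lemma IsTrivial.pullback {V : Type v} [AddCommGroup V] [Module ℝ V] [DiffeologicalSpace V]
    {X : VectorFamily.{w, e} B} (h : X.IsTrivial V) (f : B' → B)
    (hf : DSmooth f) : (X.pullback f hf).IsTrivial V := by
  obtain ⟨h, h1, h2⟩ := h
  have hr : ∀ y, h (h.symm y) = y := h.toEquiv.apply_symm_apply
  have hl : ∀ y, h.symm (h y) = y := h.toEquiv.symm_apply_apply
  refine ⟨⟨⟨fun z => (z.1.1, (h z.1.2).2),
    fun y => ⟨(y.1, h.symm (f y.1, y.2)), by rw [← h1, hr]⟩,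
    fun z => Subtype.ext (Prod.ext rfl ?_), fun y => Prod.ext rfl ?_⟩, ?_, dsmooth_subtype ?_⟩,
    fun _ => rfl, fun b => ?_⟩
  · change h.symm (f z.1.1, (h z.1.2).2) = z.1.2
    rw [z.2, ← h1, Prod.mk.eta, hl]
  · change (h (h.symm (f y.1, y.2))).2 = y.2
    rw [hr]
  · exact dsmooth_mk (dsmooth_fst.comp (dsmooth_val _))
      (dsmooth_snd.comp (h.smooth_toFun.comp (dsmooth_snd.comp (dsmooth_val _))))
  · exact dsmooth_mk dsmooth_fst
      (h.smooth_invFun.comp (dsmooth_mk (hf.comp dsmooth_fst) dsmooth_snd))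
  · exact ((h2 (f b)).mk' _ ∘ₗ (isLinearMap_pullbackFiber f hf X b).mk' _).isLinear

lemma IsLocallyTrivial.of_iso {V : Type v} [AddCommGroup V] [Module ℝ V] [DiffeologicalSpace V]
    {X : VectorFamily.{w, e} B} {Y : VectorFamily.{w, e'} B}
    (h : X.Isomorphic Y) (hY : Y.IsLocallyTrivial V) : X.IsLocallyTrivial V := by
  obtain ⟨𝒰, h1, h2, h3⟩ := hY
  exact ⟨𝒰, h1, h2, fun U hU => (h3 U hU).of_iso (h.pullback _ (dsmooth_val _))⟩

lemma IsDiffeologicalVectorSpace.pullback {X : VectorFamily.{w, e} B}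
    (h : X.IsDiffeologicalVectorSpace) (f : B' → B) (hf : DSmooth f) :
    (X.pullback f hf).IsDiffeologicalVectorSpace where
  smooth_add := by
    refine dsmooth_subtype (dsmooth_mk
      (dsmooth_fst.comp ((dsmooth_val _).comp (dsmooth_snd.comp (dsmooth_val _)))) ?_)
    have hE : ∀ (b c : B) (hbc : b = c) (x y : X.E) (hx : X.proj x = b) (hy : X.proj y = b),
        ((⟨x, hx⟩ + ⟨y, hy⟩ : Fiber X.proj b) : X.E) =
          ((⟨x, hx.trans hbc⟩ + ⟨y, hy.trans hbc⟩ : Fiber X.proj c) : X.E) := by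
      rintro b _ rfl x y hx hy
      rfl
    have hm : DSmooth (fun z : {z : (X.pullback f hf).E × (X.pullback f hf).E //
        (X.pullback f hf).proj z.1 = (X.pullback f hf).proj z.2} =>
        (⟨(z.1.1.1.2, z.1.2.1.2), z.1.1.2.symm.trans ((congrArg f z.2).trans z.1.2.2)⟩ :
          {z : X.E × X.E // X.proj z.1 = X.proj z.2})) :=
      dsmooth_subtype (dsmooth_mk
        (dsmooth_snd.comp ((dsmooth_val _).comp (dsmooth_fst.comp (dsmooth_val _))))
        (dsmooth_snd.comp ((dsmooth_val _).comp (dsmooth_snd.comp (dsmooth_val _)))))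
    convert h.smooth_add.comp hm using 1
    funext z
    exact hE _ _ z.1.2.2 _ _ _ _
  smooth_smul := by
    refine dsmooth_subtype (dsmooth_mk
      (dsmooth_fst.comp ((dsmooth_val _).comp dsmooth_snd)) ?_)
    have hE : ∀ (b c : B) (hbc : b = c) (r : ℝ) (x : X.E) (hx : X.proj x = b),
        ((r • ⟨x, hx⟩ : Fiber X.proj b) : X.E) =
          ((r • ⟨x, hx.trans hbc⟩ : Fiber X.proj c) : X.E) := by
      rintro b _ rfl r x hx
      rfl
    have hm : DSmooth (fun z : ℝ × (X.pullback f hf).E => (z.1, z.2.1.2)) :=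
      dsmooth_mk dsmooth_fst (dsmooth_snd.comp ((dsmooth_val _).comp dsmooth_snd))
    convert h.smooth_smul.comp hm using 1
    funext z
    exact hE _ _ z.2.2 _ _ _
  smooth_zero := dsmooth_subtype (dsmooth_mk dSmooth_id (h.smooth_zero.comp hf))

lemma IsVectorBundle.pullback {V : Type v} [AddCommGroup V] [Module ℝ V] [DiffeologicalSpace V]
    {X : VectorFamily.{w, e} B} (h : X.IsVectorBundle V) (f : B' → B)
    (hf : DSmooth f) : (X.pullback f hf).IsVectorBundle V :=
  ⟨h.isDVS.pullback f hf, fun n U hU p hp =>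
    (h.locallyTrivial n U hU (f ∘ p) (hf.comp hp)).of_iso (X.pullback_comp f hf p hp).symm⟩

lemma restrict_pullback {V : Type v} [AddCommGroup V] [Module ℝ V] [DiffeologicalSpace V]
    (X : VectorFamily.{w, e} B) (f : B' → B) (hf : DSmooth f) (U : Set B)
    (h : (X.restrict U).IsTrivial V) :
    ((X.pullback f hf).restrict (f ⁻¹' U)).IsTrivial V := by
  have hr : DSmooth (fun x : f ⁻¹' U => (⟨f x.1, x.2⟩ : U)) :=
    dsmooth_subtype (hf.comp (dsmooth_val _))
  have h1 := X.pullback_comp f hf (Subtype.val : f ⁻¹' U → B') (dsmooth_val _)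
  have h2 := X.pullback_comp (Subtype.val : U → B) (dsmooth_val _) _ hr
  exact (h.pullback _ hr).of_iso (h1.symm.trans h2)

end VectorFamily

/-! ### Isomorphism classes as functors of the base -/

/-- The category of diffeological spaces and smooth maps. -/
structure DiffSp : Type (u + 1) where
  carrier : Type u
  [str : DiffeologicalSpace carrier]

attribute [instance] DiffSp.str

instance : CoeSort DiffSp.{u} (Type u) := ⟨DiffSp.carrier⟩

instance : Category DiffSp.{u} where
  Hom X Y := {f : X → Y // DSmooth f}
  id _ := ⟨id, dSmooth_id⟩
  comp f g := ⟨g.1 ∘ f.1, g.2.comp f.2⟩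

section Principal

variable (G : Type u) [Group G] [DiffeologicalSpace G] [DiffeologicalGroup G]

/-- Principal `G`-bundles over `B`. -/
def PrincipalBundle (B : Type u) [DiffeologicalSpace B] : Type (u + 1) :=
  {P : GSpace.{u, u, u} G B // P.IsPrincipal}

instance principalSetoid (B : Type u) [DiffeologicalSpace B] : Setoid (PrincipalBundle G B) where
  r P Q := P.1.Isomorphic Q.1
  iseqv := ⟨fun P => .refl P.1, fun h => h.symm, fun h k => h.trans k⟩

/-- `Prin_G`: isomorphism classes of principal `G`-bundles, a functor under pullback. -/
def Prin : DiffSp.{u}ᵒᵖ ⥤ Type (u + 1) where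
  obj B := Quotient (principalSetoid G B.unop)
  map f := TypeCat.ofHom (Quotient.map
    (fun P => ⟨P.1.pullback f.unop.1 f.unop.2, P.2.pullback _ _⟩) fun _ _ h => h.pullback _ f.unop.2)
  map_id B := by
    ext x
    induction x using Quotient.inductionOn with
    | h P => exact Quotient.sound P.1.pullback_id
  map_comp f g := by
    ext x
    induction x using Quotient.inductionOn with
    | h P => exact Quotient.sound (P.1.pullback_comp f.unop.1 f.unop.2 g.unop.1 g.unop.2)

/-- `Prin_G^D`: isomorphism classes of `D`-numerable principal `G`-bundles. -/
def PrinD : Subfunctor (Prin.{u} G) where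
  obj B := {x | ∃ P : PrincipalBundle G B.unop, x = Quotient.mk _ P ∧ P.1.IsNumerable}
  map {B B'} f := by
    rintro _ ⟨P, rfl, hP⟩
    exact ⟨⟨P.1.pullback f.unop.1 f.unop.2, P.2.pullback _ _⟩, rfl,
      NumerablyTrivial.pullback hP f.unop.2 fun U hU => P.1.restrict_pullback _ f.unop.2 U hU⟩

end Principal

section Vector

variable (V : Type u) [AddCommGroup V] [Module ℝ V] [DiffeologicalSpace V]
  [DiffeologicalVectorSpace V]

/-- Vector bundles of fiber type `V` over `B`. -/
def VectorBundle (B : Type u) [DiffeologicalSpace B] : Type (u + 1) :=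
  {X : VectorFamily.{u, u} B // X.IsVectorBundle V}

instance vectorSetoid (B : Type u) [DiffeologicalSpace B] : Setoid (VectorBundle V B) where
  r X Y := X.1.Isomorphic Y.1
  iseqv := ⟨fun X => .refl X.1, fun h => h.symm, fun h k => h.trans k⟩

/-- `VB_V`: isomorphism classes of vector bundles of fiber type `V`, a functor under pullback. -/
def VB : DiffSp.{u}ᵒᵖ ⥤ Type (u + 1) where
  obj B := Quotient (vectorSetoid V B.unop)
  map f := TypeCat.ofHom (Quotient.map
    (fun X => ⟨X.1.pullback f.unop.1 f.unop.2, X.2.pullback _ _⟩) fun _ _ h => h.pullback _ f.unop.2)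
  map_id B := by
    ext x
    induction x using Quotient.inductionOn with
    | h X => exact Quotient.sound X.1.pullback_id
  map_comp f g := by
    ext x
    induction x using Quotient.inductionOn with
    | h X => exact Quotient.sound (X.1.pullback_comp f.unop.1 f.unop.2 g.unop.1 g.unop.2)

/-- `VB_V^D`: isomorphism classes of `D`-numerable vector bundles of fiber type `V`. -/
def VBD : Subfunctor (VB.{u} V) where
  obj B := {x | ∃ X : VectorBundle V B.unop, x = Quotient.mk _ X ∧ X.1.IsNumerable V}
  map {B B'} f := by
    rintro _ ⟨X, rfl, hX⟩
    exact ⟨⟨X.1.pullback f.unop.1 f.unop.2, X.2.pullback _ _⟩, rfl,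
      NumerablyTrivial.pullback hX f.unop.2 fun U hU => X.1.restrict_pullback _ f.unop.2 U hU⟩

end Vector

/-! ### The associated bundle -/

namespace GSpace

variable {G : Type v} [Group G] [DiffeologicalSpace G] {B : Type w} [DiffeologicalSpace B]

/-- A point of a principal bundle over `b` gives an equivariant bijection of the fiber with `G`. -/
lemma IsPrincipal.exists_fiber {P : GSpace.{v, w, e} G B} (h : P.IsPrincipal) (b : B) :
    ∃ φ : Fiber P.proj b → G, Function.Bijective φ ∧
      ∀ (x : Fiber P.proj b) (g : G), φ ⟨P.act x.1 g, (P.proj_act _ _).trans x.2⟩ = φ x * g := by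
  obtain ⟨𝒰, -, h2, h3⟩ := h 0 Set.univ isOpen_univ (fun _ => b) dSmooth_const
  have hpt : (⟨0, trivial⟩ : (Set.univ : Set (Cart 0))) ∈ ⋃₀ 𝒰 := by rw [h2]; trivial
  obtain ⟨U, hU, hpU⟩ := hpt
  obtain ⟨k, k1, k2⟩ := h3 U hU
  let lift : Fiber P.proj b → ((P.pullback (fun _ : (Set.univ : Set (Cart 0)) => b)
      dSmooth_const).restrict U).E :=
    fun x => ⟨(⟨_, hpU⟩, ⟨(⟨0, trivial⟩, x.1), x.2.symm⟩), rfl⟩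
  refine ⟨fun x => (k (lift x)).2, ⟨fun x y hxy => ?_, fun g => ?_⟩, fun x g => ?_⟩
  · have : lift x = lift y := k.toEquiv.injective (Prod.ext ((k1 (lift x)).trans (k1 (lift y)).symm) hxy)
    exact Subtype.ext (congrArg (fun z => z.1.2.1.2) this)
  · obtain ⟨z, hz⟩ := k.toEquiv.surjective (⟨_, hpU⟩, g)
    refine ⟨⟨z.1.2.1.2, z.1.2.2.symm⟩, ?_⟩
    have : lift ⟨z.1.2.1.2, z.1.2.2.symm⟩ = z :=
      Subtype.ext (Prod.ext (Subtype.ext (Subtype.ext (Subsingleton.elim _ _)))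
        (Subtype.ext (Prod.ext (Subtype.ext (Subsingleton.elim _ _)) rfl)))
    exact (congrArg (fun z => (k z).2) this).trans (congrArg Prod.snd hz)
  · exact congrArg Prod.snd (k2 (lift x) g)

lemma IsPrincipal.exists_point {P : GSpace.{v, w, e} G B} (h : P.IsPrincipal) (b : B) :
    Nonempty (Fiber P.proj b) := by
  obtain ⟨φ, hφ, -⟩ := h.exists_fiber b
  exact ⟨(hφ.2 1).choose⟩

lemma IsPrincipal.exists_act {P : GSpace.{v, w, e} G B} (h : P.IsPrincipal) {x y : P.E}
    (hxy : P.proj x = P.proj y) : ∃ g, P.act x g = y := by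
  obtain ⟨φ, hφ, hφg⟩ := h.exists_fiber (P.proj y)
  refine ⟨(φ ⟨x, hxy⟩)⁻¹ * φ ⟨y, rfl⟩, ?_⟩
  have := hφ.1 (a₂ := ⟨y, rfl⟩) ((hφg ⟨x, hxy⟩ _).trans (mul_inv_cancel_left _ _))
  exact congrArg Subtype.val this

lemma IsPrincipal.act_free {P : GSpace.{v, w, e} G B} (h : P.IsPrincipal) {x : P.E} {g : G}
    (hx : P.act x g = x) : g = 1 := by
  obtain ⟨φ, hφ, hφg⟩ := h.exists_fiber (P.proj x)
  have h1 := hφg ⟨x, rfl⟩ g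
  have h2 : (⟨P.act x g, P.proj_act _ _⟩ : Fiber P.proj (P.proj x)) = ⟨x, rfl⟩ := Subtype.ext hx
  rw [h2] at h1
  exact mul_eq_left.mp h1.symm

end GSpace

section Assoc

variable {V : Type u} [AddCommGroup V] [Module ℝ V] [DiffeologicalSpace V]
  {B : Type u} [DiffeologicalSpace B]

/-- The relation `(y, v) ∼ (y · g, g⁻¹ v)` on `E × V`, for `g` in `GL(V)`. -/
def assocSetoid (P : GSpace.{u, u, u} (GLin V) B) : Setoid (P.E × V) where
  r a b := ∃ g : GLin V, b = (P.act a.1 g, (g⁻¹).1 a.2)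
  iseqv :=
    { refl := fun a => ⟨1, Prod.ext (P.act_one _).symm rfl⟩
      symm := by
        rintro a b ⟨g, rfl⟩
        refine ⟨g⁻¹, Prod.ext ?_ ?_⟩
        · change a.1 = P.act (P.act a.1 g) g⁻¹
          rw [← P.act_mul, mul_inv_cancel, P.act_one]
        · change a.2 = ((g⁻¹)⁻¹).1 ((g⁻¹).1 a.2)
          rw [inv_inv]
          exact (g.1.toEquiv.apply_symm_apply _).symm
      trans := by
        rintro a b c ⟨g, rfl⟩ ⟨k, rfl⟩
        refine ⟨g * k, Prod.ext (P.act_mul _ _ _).symm ?_⟩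
        change (k⁻¹).1 ((g⁻¹).1 a.2) = ((g * k)⁻¹).1 a.2
        rw [mul_inv_rev]
        rfl }

/-- The associated space `E ×_{GL(V)} V`, with the quotient diffeology. -/
abbrev AssocTotal (P : GSpace.{u, u, u} (GLin V) B) : Type u := Quotient (assocSetoid P)

/-- The projection `[y, v] ↦ π y`. -/
def assocProj (P : GSpace.{u, u, u} (GLin V) B) : AssocTotal P → B :=
  Quotient.lift (fun a => P.proj a.1) (by
    rintro a b ⟨g, rfl⟩
    exact (P.proj_act _ _).symm)

lemma assocProj_smooth (P : GSpace.{u, u, u} (GLin V) B) : DSmooth (assocProj P) := by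
  intro n p hp
  refine DiffeologicalSpace.locality fun x => ?_
  obtain ⟨U, hU, hx, q, hq, hqp⟩ := hp x
  refine ⟨U, hU, hx, fun {m f} hf hfs => ?_⟩
  have hs : DSmooth (fun t => q ⟨f t, hf t⟩) :=
    hq.comp (f := fun t => (⟨f t, hf t⟩ : U)) (dsmooth_subtype hfs.dSmooth)
  have h2 := (P.smooth_proj.comp (dsmooth_fst.comp hs)).isPlot
  have h3 : (assocProj P ∘ p) ∘ f = P.proj ∘ Prod.fst ∘ fun t => q ⟨f t, hf t⟩ :=
    funext fun t => congrArg (assocProj P) (hqp ⟨f t, hf t⟩).symm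
  rw [h3]
  exact h2

/-- For `x` over `b`, the map `v ↦ [x, v]` from `V` to the fiber over `b`. -/
def assocFiberMap (P : GSpace.{u, u, u} (GLin V) B) {b : B} (x : Fiber P.proj b) (v : V) :
    Fiber (assocProj P) b :=
  ⟨Quotient.mk _ (x.1, v), x.2⟩

lemma assocFiberMap_bijective (P : GSpace.{u, u, u} (GLin V) B) (h : P.IsPrincipal) {b : B}
    (x : Fiber P.proj b) : Function.Bijective (assocFiberMap P x) := by
  constructor
  · intro v v' hv
    obtain ⟨g, hg⟩ : ∃ g : GLin V, _ := Quotient.exact (congrArg Subtype.val hv)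
    have h1 : g = 1 := h.act_free (congrArg Prod.fst hg).symm
    subst h1
    exact (congrArg Prod.snd hg).symm
  · rintro ⟨z, hz⟩
    obtain ⟨⟨y, w⟩, rfl⟩ := Quotient.exists_rep z
    obtain ⟨g, hg⟩ := h.exists_act (x := x.1) (y := y) (x.2.trans hz.symm)
    refine ⟨g.1 w, Subtype.ext (Quotient.sound ⟨g, Prod.ext hg.symm ?_⟩)⟩
    exact (g.1.toEquiv.symm_apply_apply w).symm

/-- The bijection `v ↦ [x, v]` for a chosen point `x` over `b`. -/
noncomputable def assocFiberEquiv (P : GSpace.{u, u, u} (GLin V) B) (h : P.IsPrincipal) (b : B) :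
    V ≃ Fiber (assocProj P) b :=
  Equiv.ofBijective _ (assocFiberMap_bijective P h (h.exists_point b).some)

/-- The associated bundle `E ×_{GL(V)} V → B` of a principal `GL(V)`-bundle. The vector space
structure on the fiber over `b` is the one making `v ↦ [x, v]` a linear isomorphism for some, or
equivalently (see `assocFrame_isLinearMap`) for every, point `x` of the principal bundle
over `b`. -/
noncomputable def assoc (P : PrincipalBundle (GLin V) B) : VectorFamily.{u, u} B where
  E := AssocTotal P.1
  proj := assocProj P.1
  smooth_proj := assocProj_smooth P.1
  addCommGroup b := (assocFiberEquiv P.1 P.2 b).symm.addCommGroup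
  module b :=
    letI := (assocFiberEquiv P.1 P.2 b).symm.addCommGroup
    (assocFiberEquiv P.1 P.2 b).symm.module ℝ

/-- `assocFiberMap` with values in the fiber of `assoc P`. -/
def assocFrame (P : PrincipalBundle (GLin V) B) {b : B} (x : Fiber P.1.proj b) (v : V) :
    Fiber (assoc P).proj b :=
  assocFiberMap P.1 x v

lemma assocFrame_isLinearMap (P : PrincipalBundle (GLin V) B) {b : B} (x : Fiber P.1.proj b) :
    IsLinearMap ℝ (assocFrame P x) := by
  let ψ : Fiber (assoc P).proj b ≃ V := (assocFiberEquiv P.1 P.2 b).symm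
  have h0 : IsLinearMap ℝ ψ.symm := isLinearMap_symm ψ
    ⟨fun _ _ => ψ.apply_symm_apply _, fun _ _ => ψ.apply_symm_apply _⟩
  set x₀ := (P.2.exists_point b).some with hx₀
  obtain ⟨g, hg⟩ := P.2.exists_act (x := x₀.1) (y := x.1) (x₀.2.trans x.2.symm)
  have h1 : ∀ v, assocFrame P x v = ψ.symm (g.1 v) := fun v =>
    Subtype.ext (Eq.symm (Quotient.sound ⟨g, Prod.ext hg.symm
      (g.1.toEquiv.symm_apply_apply v).symm⟩))
  have hgl : IsLinearMap ℝ g.1 := g.2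
  constructor
  · intro v w
    rw [h1, h1, h1, hgl.map_add, h0.map_add]
  · intro c v
    rw [h1, h1, hgl.map_smul, h0.map_smul]

end Assoc

/-! ### The frame bundle -/

section Frame

/-- `E' = ∐_b Diff(π⁻¹(b), F)`. -/
abbrev DiffFrames {E : Type e} {B : Type w} [DiffeologicalSpace E]
    (π : E → B) (F : Type v) [DiffeologicalSpace F] : Type (max w e v) :=
  Σ b : B, DDiffeo (Fiber π b) F

/-- The diffeology on `E'`: `p` is a plot iff `s ∘ p`, the map `(u, y) ↦ p(u)(y)` on
`{(u, y) | s (p u) = π y}`, and the map `(u, x) ↦ p(u)⁻¹(x)` are smooth. -/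
instance {E : Type e} {B : Type w} [DiffeologicalSpace E] [DiffeologicalSpace B]
    (π : E → B) (F : Type v) [DiffeologicalSpace F] : DiffeologicalSpace (DiffFrames π F) where
  plots n := {p | DSmooth (fun t => (p t).1) ∧
    DSmooth (fun z : {z : Cart n × E // (p z.1).1 = π z.2} => (p z.1.1).2 ⟨z.1.2, z.2.symm⟩) ∧
    DSmooth (fun z : Cart n × F => ((p z.1).2.symm z.2).1)}
  constant_plots a := by
    refine ⟨dSmooth_const, ?_, ?_⟩
    · exact a.2.smooth_toFun.comp (f := fun z : {z : Cart _ × E // a.1 = π z.2} =>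
        (⟨z.1.2, z.2.symm⟩ : Fiber π a.1)) (dsmooth_subtype (dsmooth_snd.comp (dsmooth_val _)))
    · exact (dsmooth_val _).comp (a.2.smooth_invFun.comp dsmooth_snd)
  plot_reparam {n m p f} hp hf := by
    refine ⟨hp.1.comp hf.dSmooth, ?_, ?_⟩
    · exact hp.2.1.comp (f := fun z : {z : Cart n × E // (p (f z.1)).1 = π z.2} =>
        (⟨(f z.1.1, z.1.2), z.2⟩ : {z : Cart m × E // (p z.1).1 = π z.2}))
        (dsmooth_subtype (dsmooth_mk (hf.dSmooth.comp (dsmooth_fst.comp (dsmooth_val _)))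
          (dsmooth_snd.comp (dsmooth_val _))))
    · exact hp.2.2.comp (dsmooth_mk (hf.dSmooth.comp dsmooth_fst) dsmooth_snd)
  locality {n p} h := by
    refine ⟨?_, ?_, ?_⟩
    · refine DSmooth.comp' (f := id) (g := fun t => (p t).1) ?_ dSmooth_id
      refine IsPlot.dSmooth (DiffeologicalSpace.locality fun s => ?_)
      obtain ⟨U, hU, hs, h'⟩ := h s
      exact ⟨U, hU, hs, fun hg hgs => (h' hg hgs).1.isPlot⟩
    · intro m q hq
      refine DiffeologicalSpace.locality fun s => ?_
      obtain ⟨U, hU, hs, h'⟩ := h (q s).1.1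
      have hq1 : ContDiff ℝ (⊤ : ℕ∞) (fun t => (q t).1.1) :=
        IsPlot.contDiff (X := Cart n) hq.1
      refine ⟨(fun t => (q t).1.1) ⁻¹' U, hU.preimage hq1.continuous, hs, fun {k g} hg hgs => ?_⟩
      have key := h' (m := k) (f := fun r => (q (g r)).1.1) hg (hq1.comp hgs)
      exact key.2.1 k (fun r => ⟨(r, (q (g r)).1.2), (q (g r)).2⟩)
        ⟨isPlot_id, isPlot_reparam hq.2 hgs⟩
    · intro m q hq
      refine DiffeologicalSpace.locality fun s => ?_
      obtain ⟨U, hU, hs, h'⟩ := h (q s).1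
      have hq1 : ContDiff ℝ (⊤ : ℕ∞) (fun t => (q t).1) := IsPlot.contDiff (X := Cart n) hq.1
      refine ⟨(fun t => (q t).1) ⁻¹' U, hU.preimage hq1.continuous, hs, fun {k g} hg hgs => ?_⟩
      have key := h' (m := k) (f := fun r => (q (g r)).1) hg (hq1.comp hgs)
      exact key.2.2 k (fun r => (r, (q (g r)).2)) ⟨isPlot_id, isPlot_reparam hq.2 hgs⟩

variable {V : Type u} [AddCommGroup V] [Module ℝ V] [DiffeologicalSpace V]
  {B : Type u} [DiffeologicalSpace B]

/-- `E'' = ∐_b Isom(π⁻¹(b), V)`, with the sub-diffeology of `E'`. -/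
abbrev LinearFrames (V : Type u) [AddCommGroup V] [Module ℝ V] [DiffeologicalSpace V]
    (X : VectorFamily.{u, u} B) : Type u :=
  {f : DiffFrames X.proj V // IsLinearMap ℝ f.2}

/-- The frame bundle `E'' → B`, with `GL(V)` acting by `f · g = g⁻¹ ∘ f`. -/
def frame (V : Type u) [AddCommGroup V] [Module ℝ V] [DiffeologicalSpace V]
    (X : VectorFamily.{u, u} B) : GSpace.{u, u, u} (GLin V) B where
  E := LinearFrames V X
  proj f := f.1.1
  smooth_proj := fun n p (hp : IsPlot (fun t => (p t).1)) => hp.1.isPlot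
  act f g := ⟨⟨f.1.1, f.1.2.trans (g⁻¹).1⟩,
    (((g⁻¹).2 : IsLinearMap ℝ (g⁻¹).1).mk' _ ∘ₗ f.2.mk' _).isLinear⟩
  smooth_act := dsmooth_subtype fun n p hp => by
    obtain ⟨⟨h1, h2, h3⟩, h4, h5⟩ := hp
    refine ⟨h1, ?_, ?_⟩
    · exact h5.comp (dsmooth_mk (dsmooth_fst.comp (dsmooth_val _)) h2)
    · exact h3.comp (dsmooth_mk dsmooth_fst h4)
  act_one _ := rfl
  act_mul f g k := by
    refine Subtype.ext (Sigma.ext rfl (heq_of_eq ?_))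
    change f.1.2.trans ((g * k)⁻¹).1 = (f.1.2.trans (g⁻¹).1).trans (k⁻¹).1
    rw [mul_inv_rev]
    rfl
  proj_act _ _ := rfl

end Frame

end DiffBundle

namespace DiffBundle

/-! ### Locality of smoothness -/

/-! Both constructions are governed by one principle: trivializing a bundle along a smooth map `f :
B' → B` amounts to choosing a smooth section along `f`. On the principal side this rests on the
division map `(x, x · g) ↦ g`. In a trivialization it is a product of an inverse and a group
element, and since the action is free the local divisions agree, so division is smooth
(`GSpace.IsPrincipal.hasSmoothDivision`). A section `σ` along `f` then gives the trivialization `(b,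
g) ↦ σ b · g`. On the vector side, a smooth family of linear frames along `f` is a trivialization of
the pullback (`VectorFamily.isTrivial_pullback_of_frame`, `VectorFamily.IsTrivial.exists_frame`).
The frame bundle has the smooth division `f ∘ f'⁻¹` by the very choice of its diffeology.

Trivializations of `X` therefore become sections, hence trivializations, of its frame bundle.
Conversely a point `y` of `P` defines the frame `[y, v] ↦ v` of the associated bundle, and
`assocLinearFrame` is smooth and equivariant, so sections of `P` become frames of `assoc P`. Taking
`f` to be a plot restricted to an open set gives local triviality. Taking `f` to be the inclusion of
a `D`-open set transfers numerability, with the same cover and partition of unity.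

The constructions are mutually inverse for two reasons. A smooth equivariant map over the base
between principal bundles is an isomorphism; applied to `assocLinearFrame`, this identifies `P` with
the frames of `assoc P`. In the other direction `[f, v] ↦ f⁻¹ v` is a fiberwise linear bijection
along which smooth families lift locally, so `assoc_isomorphic_of` applies. The same criterion shows
that the associated bundle respects isomorphisms and pullbacks, which gives naturality. -/

/-- This is the sheaf condition for the plots `f ∘ p`; it reduces smoothness to finding a smooth
formula near each parameter. -/
lemma dsmooth_of_locally {X : Type u} {Y : Type v} [DiffeologicalSpace X] [DiffeologicalSpace Y]
    {f : X → Y} (h : ∀ (n : ℕ) (p : Cart n → X), DSmooth p → ∀ x, ∃ U : Set (Cart n), IsOpen U ∧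
      x ∈ U ∧ DSmooth (fun t : U => f (p t.1))) : DSmooth f := by
  intro n p hp
  refine DiffeologicalSpace.locality fun x => ?_
  obtain ⟨U, hU, hx, hs⟩ := h n p hp.dSmooth x
  refine ⟨U, hU, hx, fun {m r} hr hrs => ?_⟩
  exact (hs.comp (f := fun t => (⟨r t, hr t⟩ : U)) (dsmooth_subtype hrs.dSmooth)).isPlot

/-- The inverse of a bijection is smooth if smooth families locally lift along the bijection. -/
lemma dsmooth_symm_of_locally_lift {X : Type u} {Y : Type v} [DiffeologicalSpace X]
    [DiffeologicalSpace Y] (k : X ≃ Y) (h : ∀ (n : ℕ) (q : Cart n → Y), DSmooth q → ∀ t,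
      ∃ U : Set (Cart n), IsOpen U ∧ t ∈ U ∧
        ∃ r : U → X, DSmooth r ∧ ∀ s : U, k (r s) = q s.1) : DSmooth k.invFun := by
  refine dsmooth_of_locally fun n q hq t => ?_
  obtain ⟨U, hU, ht, r, hr, hrq⟩ := h n q hq t
  refine ⟨U, hU, ht, ?_⟩
  have : (fun s : U => k.invFun (q s.1)) = r := funext fun s => k.symm_apply_eq.mpr (hrq s).symm
  rwa [this]

section Quotient

variable {X : Type u} [DiffeologicalSpace X] (s : Setoid X)

lemma dsmooth_quotient_mk : DSmooth (Quotient.mk s) := fun _ p hp _ =>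
  ⟨Set.univ, isOpen_univ, trivial, fun y => p y.1, hp.dSmooth.comp (dsmooth_val _), fun _ => rfl⟩

variable {s}

/-- Smooth families in a quotient locally lift. -/
lemma exists_lift_of_dsmooth {n : ℕ} {p : Cart n → Quotient s} (hp : DSmooth p) (x : Cart n) :
    ∃ U : Set (Cart n), IsOpen U ∧ x ∈ U ∧
      ∃ q : U → X, DSmooth q ∧ ∀ y : U, Quotient.mk s (q y) = p y :=
  hp.isPlot x

end Quotient

/-! ### Principal bundles, sections and divisions -/

namespace GSpace

variable {G : Type v} [Group G] [DiffeologicalSpace G]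
variable {B : Type w} [DiffeologicalSpace B] {B' : Type w'} [DiffeologicalSpace B']

/-- The action is free and transitive on the fibers, with smooth division map
`E ×_B E → G`. -/
def HasSmoothDivision (P : GSpace.{v, w, e} G B) : Prop :=
  ∃ δ : {z : P.E × P.E // P.proj z.1 = P.proj z.2} → G, DSmooth δ ∧
    (∀ z, P.act z.1.1 (δ z) = z.1.2) ∧
    ∀ x g, δ ⟨(x, P.act x g), (P.proj_act x g).symm⟩ = g

/-- The trivialization is inverse to `(b, g) ↦ σ b · g`, and dividing by `σ` supplies its smooth
forward map. Only smooth division is assumed, not local triviality, so this can be used to prove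
that a frame bundle is principal. -/
lemma HasSmoothDivision.isTrivial_pullback {P : GSpace.{v, w, e} G B} (h : P.HasSmoothDivision)
    {f : B' → B} (hf : DSmooth f) {σ : B' → P.E} (hσ : DSmooth σ)
    (hσf : ∀ b, P.proj (σ b) = f b) : (P.pullback f hf).IsTrivial := by
  obtain ⟨δ, hδ, h1, h2⟩ := h
  have h2' : ∀ (x y : P.E) (hxy : P.proj x = P.proj y) (g : G), P.act x g = y →
      δ ⟨(x, y), hxy⟩ = g := by
    rintro x _ hxy g rfl
    exact h2 x g
  refine ⟨⟨⟨fun z => (z.1.1, δ ⟨(σ z.1.1, z.1.2), (hσf _).trans z.2⟩),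
    fun y => ⟨(y.1, P.act (σ y.1) y.2), (hσf _).symm.trans (P.proj_act _ _).symm⟩,
    fun z => Subtype.ext (Prod.ext rfl (h1 ⟨(σ z.1.1, z.1.2), (hσf _).trans z.2⟩)),
    fun y => Prod.ext rfl (h2 _ _)⟩, ?_, ?_⟩, fun _ => rfl, fun z g => Prod.ext rfl ?_⟩
  · exact dsmooth_mk (dsmooth_fst.comp (dsmooth_val _)) (hδ.comp (dsmooth_subtype
      (dsmooth_mk (hσ.comp (dsmooth_fst.comp (dsmooth_val _)))
        (dsmooth_snd.comp (dsmooth_val _)))))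
  · exact dsmooth_subtype (dsmooth_mk dsmooth_fst
      (P.smooth_act.comp (dsmooth_mk (hσ.comp dsmooth_fst) dsmooth_snd)))
  · refine h2' _ _ _ _ ?_
    rw [P.act_mul]
    exact congrArg (fun x => P.act x g) (h1 ⟨(σ z.1.1, z.1.2), (hσf _).trans z.2⟩)

/-- The section is the image of the unit section `b ↦ (b, 1)` of the product. -/
lemma IsTrivial.exists_section {P : GSpace.{v, w, e} G B} {f : B' → B} {hf : DSmooth f}
    (h : (P.pullback f hf).IsTrivial) :
    ∃ σ : B' → P.E, DSmooth σ ∧ ∀ b, P.proj (σ b) = f b := by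
  obtain ⟨k, k1, -⟩ := h
  have hr : ∀ y, k (k.symm y) = y := k.toEquiv.apply_symm_apply
  refine ⟨fun b => (k.symm (b, 1)).1.2, ?_, fun b => ?_⟩
  · exact dsmooth_snd.comp ((dsmooth_val _).comp
      (k.smooth_invFun.comp (dsmooth_mk dSmooth_id dSmooth_const)))
  · refine (k.symm (b, 1)).2.symm.trans (congrArg f ?_)
    exact (k1 _).symm.trans (congrArg Prod.fst (hr (b, 1)))

/-- Over the domain of a trivialization, the division map is smooth. -/
lemma IsTrivial.exists_division [DiffeologicalGroup G] {P : GSpace.{v, w, e} G B} {f : B' → B}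
    {hf : DSmooth f} (h : (P.pullback f hf).IsTrivial) {x y : B' → P.E} (hx : DSmooth x)
    (hy : DSmooth y) (hxf : ∀ b, f b = P.proj (x b)) (hyf : ∀ b, f b = P.proj (y b)) :
    ∃ g : B' → G, DSmooth g ∧ ∀ b, P.act (x b) (g b) = y b := by
  obtain ⟨k, k1, k2⟩ := h
  let X : B' → (P.pullback f hf).E := fun b => ⟨(b, x b), hxf b⟩
  let Y : B' → (P.pullback f hf).E := fun b => ⟨(b, y b), hyf b⟩
  have hX : DSmooth X := dsmooth_subtype (dsmooth_mk dSmooth_id hx)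
  have hY : DSmooth Y := dsmooth_subtype (dsmooth_mk dSmooth_id hy)
  refine ⟨fun b => (k (X b)).2⁻¹ * (k (Y b)).2, ?_, fun b => ?_⟩
  · exact DiffeologicalGroup.smooth_mul.comp (dsmooth_mk
      (DiffeologicalGroup.smooth_inv.comp (dsmooth_snd.comp (k.smooth_toFun.comp hX)))
      (dsmooth_snd.comp (k.smooth_toFun.comp hY)))
  · have : (P.pullback f hf).act (X b) ((k (X b)).2⁻¹ * (k (Y b)).2) = Y b := by
      refine k.toEquiv.injective ((k2 _ _).trans (Prod.ext ?_ (mul_inv_cancel_left _ _)))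
      exact (k1 (X b)).trans (k1 (Y b)).symm
    exact congrArg (fun z => z.1.2) this

lemma IsTrivial.pullback_of_restrict {P : GSpace.{v, w, e} G B} {f : B' → B} {hf : DSmooth f}
    {U : Set B'} (h : ((P.pullback f hf).restrict U).IsTrivial) :
    (P.pullback (fun t : U => f t.1) (hf.comp (dsmooth_val _))).IsTrivial :=
  h.of_iso (P.pullback_comp f hf Subtype.val (dsmooth_val _))

lemma IsTrivial.restrict_of_pullback {P : GSpace.{v, w, e} G B} {f : B' → B} {hf : DSmooth f}
    {U : Set B'} (h : (P.pullback (fun t : U => f t.1) (hf.comp (dsmooth_val _))).IsTrivial) :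
    ((P.pullback f hf).restrict U).IsTrivial :=
  h.of_iso (P.pullback_comp f hf Subtype.val (dsmooth_val _)).symm

/-- The definition yields a cover of the subtype `Set.univ` by `D`-open sets. The identification of
the Cartesian space with that subtype is a plot, so such a set pulls back to a genuinely open set.
-/
lemma IsPrincipal.isTrivial_nhds {P : GSpace.{v, w, e} G B} (h : P.IsPrincipal) {n : ℕ}
    {p : Cart n → B} (hp : DSmooth p) (x : Cart n) : ∃ U : Set (Cart n), IsOpen U ∧ x ∈ U ∧
      (P.pullback (fun t : U => p t.1) (hp.comp (dsmooth_val _))).IsTrivial := by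
  obtain ⟨𝒰, h1, h2, h3⟩ := h n Set.univ isOpen_univ (fun t => p t.1) (hp.comp (dsmooth_val _))
  have hx : (⟨x, trivial⟩ : (Set.univ : Set (Cart n))) ∈ ⋃₀ 𝒰 := by rw [h2]; trivial
  obtain ⟨W, hW, hxW⟩ := hx
  have hι : DSmooth (fun t : Cart n => (⟨t, trivial⟩ : (Set.univ : Set (Cart n)))) :=
    dsmooth_subtype dSmooth_id
  refine ⟨_, isOpen_iff_preimages_plots.mp (h1 W hW) n _ hι.isPlot, hxW, ?_⟩
  exact ((restrict_pullback _ _ hι W (h3 W hW)).pullback_of_restrict).of_iso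
    (P.pullback_comp _ (hp.comp (dsmooth_val _)) _ (hι.comp (dsmooth_val _)))

/-- Transitivity on fibers provides the quotient pointwise, by choice. Freeness makes it unique, so
it must agree with the smooth quotient computed in any local trivialization. -/
lemma IsPrincipal.hasSmoothDivision [DiffeologicalGroup G] {P : GSpace.{v, w, e} G B}
    (h : P.IsPrincipal) : P.HasSmoothDivision := by
  choose δ hδ using fun z : {z : P.E × P.E // P.proj z.1 = P.proj z.2} => h.exists_act z.2
  have huniq : ∀ x g g', P.act x g = P.act x g' → g = g' := fun x g g' hg => by
    have : g * g'⁻¹ = 1 := h.act_free (x := x) (by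
      rw [P.act_mul, hg, ← P.act_mul, mul_inv_cancel, P.act_one])
    exact mul_inv_eq_one.mp this
  refine ⟨δ, dsmooth_of_locally fun n p hp t => ?_, hδ, fun x g =>
    huniq x _ _ (hδ ⟨(x, P.act x g), (P.proj_act x g).symm⟩)⟩
  have hx : DSmooth (fun t => (p t).1.1) := dsmooth_fst.comp ((dsmooth_val _).comp hp)
  have hy : DSmooth (fun t => (p t).1.2) := dsmooth_snd.comp ((dsmooth_val _).comp hp)
  obtain ⟨U, hU, ht, hT⟩ := h.isTrivial_nhds (P.smooth_proj.comp hx) t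
  obtain ⟨g, hg, hxy⟩ := hT.exists_division (hx.comp (dsmooth_val _)) (hy.comp (dsmooth_val _))
    (fun _ => rfl) (fun s => (p s.1).2)
  refine ⟨U, hU, ht, ?_⟩
  have : (fun s : U => δ (p s.1)) = g := funext fun s =>
    huniq _ _ _ ((hδ (p s.1)).trans (hxy s).symm)
  rw [this]
  exact hg

/-- A smooth equivariant map over the base between principal bundles is an isomorphism. -/
lemma IsPrincipal.isomorphic_of_equivariant [DiffeologicalGroup G] {P : GSpace.{v, w, e} G B}
    {Q : GSpace.{v, w, e'} G B} (hP : P.IsPrincipal) (hQ : Q.IsPrincipal) {h : P.E → Q.E}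
    (hs : DSmooth h) (hproj : ∀ x, Q.proj (h x) = P.proj x)
    (hact : ∀ x g, h (P.act x g) = Q.act (h x) g) : P.Isomorphic Q := by
  obtain ⟨δ, hδ, h1, -⟩ := hQ.hasSmoothDivision
  have hinj : Function.Injective h := fun x y hxy => by
    obtain ⟨g, rfl⟩ := hP.exists_act ((hproj x).symm.trans ((congrArg Q.proj hxy).trans (hproj y)))
    have hg : g = 1 := hQ.act_free ((hact x g).symm.trans hxy.symm)
    rw [hg, P.act_one]
  have hsurj : Function.Surjective h := fun y => by
    obtain ⟨x, hx⟩ := hP.exists_point (Q.proj y)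
    obtain ⟨g, hg⟩ := hQ.exists_act ((hproj x).trans hx)
    exact ⟨P.act x g, (hact x g).trans hg⟩
  refine ⟨⟨Equiv.ofBijective h ⟨hinj, hsurj⟩, hs,
    dsmooth_symm_of_locally_lift _ fun n q hq t => ?_⟩, hproj, hact⟩
  -- To lift `q` along `h`, take a local section `σ` of `P` below `q`, divide `q` by `h ∘ σ` in `Q`,
  -- and let the quotient act on `σ`; equivariance sends the result to `q`.
  obtain ⟨U, hU, ht, hT⟩ := hP.isTrivial_nhds (Q.smooth_proj.comp hq) t
  obtain ⟨σ, hσ, hσq⟩ := hT.exists_section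
  exact ⟨U, hU, ht, fun s => P.act (σ s) (δ ⟨(h (σ s), q s.1), (hproj _).trans (hσq s)⟩),
    P.smooth_act.comp (dsmooth_mk hσ (hδ.comp (dsmooth_subtype
      (dsmooth_mk (hs.comp hσ) (hq.comp (dsmooth_val _)))))),
    fun s => (hact _ _).trans (h1 ⟨(h (σ s), q s.1), (hproj _).trans (hσq s)⟩)⟩

end GSpace

end DiffBundle

namespace DiffBundle

/-! ### Frame bundles -/

section Frame

variable {V : Type u} [AddCommGroup V] [Module ℝ V] [DiffeologicalSpace V]

/-- Along a plot this is the jointly smooth evaluation from the definition of the diffeology,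
composed with a graph `t ↦ (t, v t)`. -/
lemma GLin.dsmooth_apply : DSmooth (fun z : GLin V × V => z.1.1 z.2) := fun n p hp =>
  hp.1.1 n (fun t => (t, (p t).2)) ⟨isPlot_id, hp.2⟩

lemma GLin.dsmooth_of {Y : Type w} [DiffeologicalSpace Y] {g : Y → GLin V}
    (h1 : DSmooth (fun z : Y × V => (g z.1).1 z.2))
    (h2 : DSmooth (fun z : Y × V => (g z.1).1.symm z.2)) : DSmooth g := fun _ _ hp =>
  ⟨h1.comp (dsmooth_mk (hp.dSmooth.comp dsmooth_fst) dsmooth_snd),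
    h2.comp (dsmooth_mk (hp.dSmooth.comp dsmooth_fst) dsmooth_snd)⟩

variable {B : Type u} [DiffeologicalSpace B] {B' : Type w'} [DiffeologicalSpace B']

/-! ### Calculus of linear frames: evaluation, inverse and change of frame. -/

namespace LinearFrames

variable {X : VectorFamily.{u, u} B}

/-- A frame as a map defined on those points of the total space which lie over its base point. -/
def eval (f : LinearFrames V X) (x : X.E) (h : f.1.1 = X.proj x) : V := f.1.2 ⟨x, h.symm⟩

/-- The inverse of a frame, with values in the total space. -/
def point (f : LinearFrames V X) (v : V) : X.E := (f.1.2.symm v).1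

lemma proj_point (f : LinearFrames V X) (v : V) : X.proj (f.point v) = f.1.1 :=
  (f.1.2.symm v).2

lemma eval_point (f : LinearFrames V X) (v : V) (h : f.1.1 = X.proj (f.point v)) :
    f.eval (f.point v) h = v :=
  f.1.2.toEquiv.apply_symm_apply v

lemma point_eval (f : LinearFrames V X) (x : X.E) (h : f.1.1 = X.proj x) :
    f.point (f.eval x h) = x :=
  congrArg Subtype.val (f.1.2.toEquiv.symm_apply_apply ⟨x, h.symm⟩)

/-- A frame is determined by its inverse. Inverses take values in the fixed total space, so
comparing them avoids transport between fibers over merely equal base points. -/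
lemma ext_point {f f' : LinearFrames V X} (hb : f.1.1 = f'.1.1)
    (h : ∀ v, f.point v = f'.point v) : f = f' := by
  obtain ⟨⟨b, f⟩, hf⟩ := f
  obtain ⟨⟨b', f'⟩, hf'⟩ := f'
  obtain rfl : b = b' := hb
  have : f.toEquiv.symm = f'.toEquiv.symm := Equiv.ext fun v => Subtype.ext (h v)
  obtain rfl : f = f' := DDiffeo.toEquiv_inj (Equiv.symm_bijective.1 this)
  rfl

/-- The base point `b` is kept separate from that of the frame so that linearity is available in
whichever form the fiber is presented, for instance over `X.proj x`. -/
lemma isLinearMap_point (f : LinearFrames V X) {b : B} (hb : f.1.1 = b) :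
    IsLinearMap ℝ (fun v => (⟨f.point v, (f.proj_point v).trans hb⟩ : Fiber X.proj b)) := by
  subst hb
  exact isLinearMap_symm f.1.2.toEquiv f.2

lemma isLinearMap_eval (f : LinearFrames V X) {b : B} (hb : f.1.1 = b) :
    IsLinearMap ℝ (fun x : Fiber X.proj b => f.eval x.1 (hb.trans x.2.symm)) := by
  subst hb
  exact f.2

lemma dsmooth_base : DSmooth (fun f : LinearFrames V X => f.1.1) := (frame V X).smooth_proj

lemma dsmooth_eval : DSmooth (fun z : {z : LinearFrames V X × X.E // z.1.1.1 = X.proj z.2} =>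
    z.1.1.eval z.1.2 z.2) := fun n p hp =>
  hp.1.2.1 n (fun t => ⟨(t, (p t).1.2), (p t).2⟩) ⟨isPlot_id, hp.2⟩

lemma dsmooth_eval_comp {Y : Type w} [DiffeologicalSpace Y] {f : Y → LinearFrames V X}
    {x : Y → X.E} (hf : DSmooth f) (hx : DSmooth x) (h : ∀ y, (f y).1.1 = X.proj (x y)) :
    DSmooth (fun y => (f y).eval (x y) (h y)) :=
  dsmooth_eval.comp (f := fun y => (⟨(f y, x y), h y⟩ :
    {z : LinearFrames V X × X.E // z.1.1.1 = X.proj z.2})) (dsmooth_subtype (dsmooth_mk hf hx))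

lemma dsmooth_point : DSmooth (fun z : LinearFrames V X × V => z.1.point z.2) := fun n p hp =>
  hp.1.2.2 n (fun t => (t, (p t).2)) ⟨isPlot_id, hp.2⟩

lemma dsmooth_of {Y : Type w} [DiffeologicalSpace Y] {f : Y → LinearFrames V X}
    (h0 : DSmooth (fun y => (f y).1.1))
    (h1 : DSmooth (fun z : {z : Y × X.E // (f z.1).1.1 = X.proj z.2} =>
      (f z.1.1).eval z.1.2 z.2))
    (h2 : DSmooth (fun z : Y × V => (f z.1).point z.2)) : DSmooth f := by
  intro n p hp
  refine ⟨h0.comp hp.dSmooth, ?_, ?_⟩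
  · exact h1.comp (f := fun z : {z : Cart n × X.E // (f (p z.1)).1.1 = X.proj z.2} =>
      (⟨(p z.1.1, z.1.2), z.2⟩ : {z : Y × X.E // (f z.1).1.1 = X.proj z.2}))
      (dsmooth_subtype (dsmooth_mk (hp.dSmooth.comp (dsmooth_fst.comp (dsmooth_val _)))
        (dsmooth_snd.comp (dsmooth_val _))))
  · exact h2.comp (dsmooth_mk (hp.dSmooth.comp dsmooth_fst) dsmooth_snd)

/-- A linear frame of the fiber over `b`, from mutually inverse smooth maps. -/
def ofMaps (b : B) (φ : Fiber X.proj b → V) (ψ : V → Fiber X.proj b)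
    (hψφ : ∀ x, ψ (φ x) = x) (hφψ : ∀ v, φ (ψ v) = v) (hφ : DSmooth φ) (hψ : DSmooth ψ)
    (hl : IsLinearMap ℝ φ) : LinearFrames V X :=
  ⟨⟨b, ⟨⟨φ, ψ, hψφ, hφψ⟩, hφ, hψ⟩⟩, hl⟩

/-- The change of frames `f ∘ f'⁻¹`. -/
def change (f f' : LinearFrames V X) (h : f.1.1 = f'.1.1) : GLin V :=
  ⟨⟨⟨fun v => f.eval (f'.point v) (h.trans (f'.proj_point v).symm),
    fun v => f'.eval (f.point v) (h.symm.trans (f.proj_point v).symm),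
    fun v => by simp only [point_eval, eval_point],
    fun v => by simp only [point_eval, eval_point]⟩,
    dsmooth_eval_comp dSmooth_const (dsmooth_point.comp (dsmooth_mk dSmooth_const dSmooth_id))
      fun v => h.trans (f'.proj_point v).symm,
    dsmooth_eval_comp dSmooth_const (dsmooth_point.comp (dsmooth_mk dSmooth_const dSmooth_id))
      fun v => h.symm.trans (f.proj_point v).symm⟩,
    ((f.isLinearMap_eval h).mk' _ ∘ₗ (f'.isLinearMap_point rfl).mk' _).isLinear⟩

/-- The inverse of `f · g` is `f⁻¹ ∘ g`; for `g = f ∘ f'⁻¹` this is `f'⁻¹`. -/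
lemma act_change (f f' : LinearFrames V X) (h : f.1.1 = f'.1.1) :
    (frame V X).act f (f.change f' h) = f' :=
  ext_point h fun v => f.point_eval (f'.point v) (h.trans (f'.proj_point v).symm)

lemma change_act (f : LinearFrames V X) (g : GLin V) :
    f.change ((frame V X).act f g) ((frame V X).proj_act f g).symm = g := by
  refine Subtype.ext (DDiffeo.toEquiv_inj (Equiv.ext fun v => ?_))
  exact f.eval_point (g.1 v) (f.proj_point _).symm

/-- Both `f ∘ f'⁻¹` and its inverse are an evaluation after an inverse frame, and the diffeology on
frames makes these two operations jointly smooth. -/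
lemma dsmooth_change : DSmooth (fun z : {z : LinearFrames V X × LinearFrames V X //
    z.1.1.1 = z.2.1.1} => z.1.1.change z.1.2 z.2) := by
  have hfst : DSmooth (fun z : {z : LinearFrames V X × LinearFrames V X //
      z.1.1.1 = z.2.1.1} × V => z.1.1.1) := dsmooth_fst.comp ((dsmooth_val _).comp dsmooth_fst)
  have hsnd : DSmooth (fun z : {z : LinearFrames V X × LinearFrames V X //
      z.1.1.1 = z.2.1.1} × V => z.1.1.2) := dsmooth_snd.comp ((dsmooth_val _).comp dsmooth_fst)
  refine GLin.dsmooth_of ?_ ?_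
  · exact dsmooth_eval_comp hfst (dsmooth_point.comp (dsmooth_mk hsnd dsmooth_snd))
      fun z => z.1.2.trans (z.1.1.2.proj_point z.2).symm
  · exact dsmooth_eval_comp hsnd (dsmooth_point.comp (dsmooth_mk hfst dsmooth_snd))
      fun z => z.1.2.symm.trans (z.1.1.1.proj_point z.2).symm

end LinearFrames

/-! ### Frames along a map and trivializations of the pullback. -/

open LinearFrames

/-- Division in the frame bundle needs no local triviality of `X`, so a section alone already
trivializes it. -/
lemma frame_hasSmoothDivision (X : VectorFamily.{u, u} B) : (frame V X).HasSmoothDivision :=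
  ⟨fun z => LinearFrames.change z.1.1 z.1.2 z.2, dsmooth_change,
    fun z => act_change z.1.1 z.1.2 z.2, change_act⟩

/-- A smooth family of frames along `f` trivializes the pullback along `f`. -/
lemma VectorFamily.isTrivial_pullback_of_frame {X : VectorFamily.{u, u} B} {f : B' → B}
    (hf : DSmooth f) {σ : B' → LinearFrames V X} (hσ : DSmooth σ) (hσf : ∀ b, (σ b).1.1 = f b) :
    (X.pullback f hf).IsTrivial V := by
  refine ⟨⟨⟨fun z => (z.1.1, (σ z.1.1).eval z.1.2 ((hσf _).trans z.2)),
    fun y => ⟨(y.1, (σ y.1).point y.2), (hσf _).symm.trans ((σ y.1).proj_point y.2).symm⟩,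
    fun z => Subtype.ext (Prod.ext rfl ((σ z.1.1).point_eval z.1.2 ((hσf _).trans z.2))),
    fun y => Prod.ext rfl ((σ y.1).eval_point y.2 ((σ y.1).proj_point y.2).symm)⟩, ?_, ?_⟩, fun _ => rfl, fun b => ?_⟩
  · exact dsmooth_mk (dsmooth_fst.comp (dsmooth_val _)) (dsmooth_eval_comp
      (hσ.comp (dsmooth_fst.comp (dsmooth_val _))) (dsmooth_snd.comp (dsmooth_val _)) _)
  · exact dsmooth_subtype (dsmooth_mk dsmooth_fst
      (dsmooth_point.comp (dsmooth_mk (hσ.comp dsmooth_fst) dsmooth_snd)))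
  · convert (((σ b).isLinearMap_eval (hσf b)).mk' _ ∘ₗ
      (isLinearMap_pullbackFiber f hf X b).mk' _).isLinear using 1
    funext z
    obtain ⟨z, rfl⟩ := z
    rfl

/-- A trivialization of the pullback along `f` gives a smooth family of frames along `f`. -/
lemma VectorFamily.IsTrivial.exists_frame {X : VectorFamily.{u, u} B} {f : B' → B}
    {hf : DSmooth f} (h : (X.pullback f hf).IsTrivial V) :
    ∃ σ : B' → LinearFrames V X, DSmooth σ ∧ ∀ b, (σ b).1.1 = f b := by
  obtain ⟨k, k1, k2⟩ := h
  have hr : ∀ y, k (k.symm y) = y := k.toEquiv.apply_symm_apply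
  have hl : ∀ z, k.symm (k z) = z := k.toEquiv.symm_apply_apply
  have hb : ∀ y, (k.symm y).1.1 = y.1 := fun y => (k1 _).symm.trans (congrArg Prod.fst (hr y))
  have hkm : ∀ z : (X.pullback f hf).E, k z = (z.1.1, (k z).2) := fun z => Prod.ext (k1 z) rfl
  -- The frame over `b` is the `V`-component of `k` on that fiber, with inverse `v ↦ k⁻¹ (b, v)`;
  -- `hb` says that the latter indeed lies over `b`.
  refine ⟨fun b => ofMaps (f b) (fun x => (k ⟨(b, x.1), x.2.symm⟩).2)
    (fun v => ⟨(k.symm (b, v)).1.2, (k.symm (b, v)).2.symm.trans (congrArg f (hb _))⟩)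
    (fun x => Subtype.ext ?_) (fun v => ?_) ?_ ?_ ?_, LinearFrames.dsmooth_of hf ?_ ?_,
    fun _ => rfl⟩
  · have h1 := (congrArg k.symm (hkm ⟨(b, x.1), x.2.symm⟩)).symm.trans (hl _)
    exact congrArg (fun z => z.1.2) h1
  · have hz : f b = X.proj (k.symm (b, v)).1.2 :=
      (congrArg f (hb (b, v))).symm.trans (k.symm (b, v)).2
    have h1 : (⟨(b, (k.symm (b, v)).1.2), hz⟩ : (X.pullback f hf).E) = k.symm (b, v) :=
      Subtype.ext (Prod.ext (hb (b, v)).symm rfl)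
    exact (congrArg (fun z => (k z).2) h1).trans (congrArg Prod.snd (hr _))
  · exact dsmooth_snd.comp (k.smooth_toFun.comp (dsmooth_subtype
      (dsmooth_mk dSmooth_const (dsmooth_val _))))
  · exact dsmooth_subtype (dsmooth_snd.comp ((dsmooth_val _).comp
      (k.smooth_invFun.comp (dsmooth_mk dSmooth_const dSmooth_id))))
  · exact ((k2 b).mk' _ ∘ₗ (isLinearMap_pullbackFiber_symm f hf X b).mk' _).isLinear
  -- The domain of evaluation for the family is by definition the total space of the pullback, so
  -- the identity is the comparison map.
  · exact dsmooth_snd.comp (k.smooth_toFun.comp (f := fun z : {z : B' × X.E // f z.1 = X.proj z.2} =>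
      (z : (X.pullback f hf).E)) dSmooth_id)
  · exact dsmooth_snd.comp ((dsmooth_val _).comp k.smooth_invFun)

/-- Trivialization of `X` to section of frames to trivialization of frames. With `f` arbitrary, this
serves both for plots and for inclusions of subsets of the base. -/
lemma VectorFamily.IsTrivial.frame {X : VectorFamily.{u, u} B} {f : B' → B}
    {hf : DSmooth f} (h : (X.pullback f hf).IsTrivial V) :
    ((frame V X).pullback f hf).IsTrivial := by
  obtain ⟨σ, hσ, hσf⟩ := h.exists_frame
  exact (frame_hasSmoothDivision X).isTrivial_pullback hf hσ hσf

lemma VectorFamily.IsTrivial.pullback_of_restrict {X : VectorFamily.{u, e} B} {f : B' → B}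
    {hf : DSmooth f} {U : Set B'} (h : ((X.pullback f hf).restrict U).IsTrivial V) :
    (X.pullback (fun t : U => f t.1) (hf.comp (dsmooth_val _))).IsTrivial V :=
  h.of_iso (X.pullback_comp f hf Subtype.val (dsmooth_val _))

lemma VectorFamily.IsTrivial.restrict_of_pullback {X : VectorFamily.{u, e} B} {f : B' → B}
    {hf : DSmooth f} {U : Set B'}
    (h : (X.pullback (fun t : U => f t.1) (hf.comp (dsmooth_val _))).IsTrivial V) :
    ((X.pullback f hf).restrict U).IsTrivial V :=
  h.of_iso (X.pullback_comp f hf Subtype.val (dsmooth_val _)).symm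

lemma HasOpenCover.mono {B : Type w} [DiffeologicalSpace B] {T T' : Set B → Prop}
    (h : HasOpenCover T) (hT : ∀ U, T U → T' U) : HasOpenCover T' := by
  obtain ⟨𝒰, h1, h2, h3⟩ := h
  exact ⟨𝒰, h1, h2, fun U hU => hT U (h3 U hU)⟩

/-- The cover and the partition of unity are kept, so numerability passes between bundles that are
trivial over the same sets. -/
lemma NumerablyTrivial.mono {T T' : Set B → Prop} (h : NumerablyTrivial T)
    (hT : ∀ U, T U → T' U) : NumerablyTrivial T' := by
  obtain ⟨I, U, μ, h1, h2, h3, h4, h5⟩ := h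
  exact ⟨I, U, μ, h1, h2, h3, h4, fun i => hT _ (h5 i)⟩

lemma VectorFamily.IsVectorBundle.frame {X : VectorFamily.{u, u} B} (h : X.IsVectorBundle V) :
    (DiffBundle.frame V X).IsPrincipal := fun n U hU p hp =>
  (h.locallyTrivial n U hU p hp).mono fun _ hW =>
    GSpace.IsTrivial.restrict_of_pullback (P := DiffBundle.frame V X)
      (VectorFamily.IsTrivial.pullback_of_restrict hW).frame

lemma VectorFamily.IsNumerable.frame {X : VectorFamily.{u, u} B} (h : X.IsNumerable V) :
    (DiffBundle.frame V X).IsNumerable :=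
  NumerablyTrivial.mono h fun _ hU => VectorFamily.IsTrivial.frame hU

/-- Isomorphic vector bundles have isomorphic frame bundles. -/
lemma VectorFamily.Isomorphic.frame {X Y : VectorFamily.{u, u} B} (h : X.Isomorphic Y)
    (hX : X.IsVectorBundle V) (hY : Y.IsVectorBundle V) :
    (DiffBundle.frame V X).Isomorphic (DiffBundle.frame V Y) := by
  -- The isomorphism is taken from `Y` to `X` because frames move by precomposition: `Φ f = f ∘ k`.
  -- The group acts by postcomposition, which makes `Φ` equivariant.
  obtain ⟨k, k1, k2⟩ := h.symm
  have hr : ∀ y, k (k.symm y) = y := k.toEquiv.apply_symm_apply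
  have hl : ∀ y, k.symm (k y) = y := k.toEquiv.symm_apply_apply
  have k1' : ∀ x, Y.proj (k.symm x) = X.proj x := fun x => by rw [← k1, hr]
  have hs : ∀ b, DSmooth (fun x : Fiber Y.proj b =>
      (⟨k x.1, (k1 x.1).trans x.2⟩ : Fiber X.proj b)) := fun b =>
    dsmooth_subtype (k.smooth_toFun.comp (dsmooth_val _))
  have hs' : ∀ b, DSmooth (fun x : Fiber X.proj b =>
      (⟨k.symm x.1, (k1' x.1).trans x.2⟩ : Fiber Y.proj b)) := fun b =>
    dsmooth_subtype (k.smooth_invFun.comp (dsmooth_val _))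
  let Φ : LinearFrames V X → LinearFrames V Y := fun f => ofMaps f.1.1
    (fun x => f.1.2 ⟨k x.1, (k1 x.1).trans x.2⟩)
    (fun v => ⟨k.symm (f.point v), (k1' _).trans (f.proj_point v)⟩)
    (fun x => Subtype.ext ((congrArg k.symm (f.point_eval _ ((k1 x.1).trans x.2).symm)).trans
      (hl _)))
    (fun v => (congrArg f.1.2 (Subtype.ext (hr _))).trans (f.1.2.toEquiv.apply_symm_apply v))
    (f.1.2.smooth_toFun.comp (hs _))
    ((hs' _).comp f.1.2.smooth_invFun)
    (f.2.mk' _ ∘ₗ (k2 f.1.1).mk' _).isLinear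
  refine hX.frame.isomorphic_of_equivariant hY.frame (h := Φ)
    (LinearFrames.dsmooth_of dsmooth_base ?_ ?_) (fun _ => rfl)
    (fun f g => ext_point rfl fun v => rfl)
  · exact dsmooth_eval_comp (dsmooth_fst.comp (dsmooth_val _))
      (k.smooth_toFun.comp (dsmooth_snd.comp (dsmooth_val _)))
      (fun z : {z : LinearFrames V X × Y.E // z.1.1.1 = Y.proj z.2} => z.2.trans (k1 _).symm)
  · exact k.smooth_invFun.comp dsmooth_point

end Frame

end DiffBundle

namespace DiffBundle

open LinearFrames

variable {V : Type u} [AddCommGroup V] [Module ℝ V] [DiffeologicalSpace V]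
  {B : Type u} [DiffeologicalSpace B]

/-! ### Associated bundles -/

/-- A family with smooth local frames along all plots is a diffeological vector space over the
base. -/
lemma VectorFamily.isDiffeologicalVectorSpace_of_frames [DiffeologicalVectorSpace V]
    {X : VectorFamily.{u, u} B}
    (h : ∀ (n : ℕ) (p : Cart n → B), DSmooth p → ∀ t, ∃ U : Set (Cart n), IsOpen U ∧ t ∈ U ∧
      ∃ σ : U → LinearFrames V X, DSmooth σ ∧ ∀ s, (σ s).1.1 = p s.1) :
    X.IsDiffeologicalVectorSpace where
  smooth_add := dsmooth_of_locally fun n p hp t => by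
    have hx : DSmooth (fun t => (p t).1.1) := dsmooth_fst.comp ((dsmooth_val _).comp hp)
    have hy : DSmooth (fun t => (p t).1.2) := dsmooth_snd.comp ((dsmooth_val _).comp hp)
    obtain ⟨U, hU, ht, σ, hσ, hσp⟩ := h n _ (X.smooth_proj.comp hy) t
    have hσp' : ∀ s : U, (σ s).1.1 = X.proj (p s.1).1.1 := fun s =>
      (hσp s).trans (p s.1).2.symm
    refine ⟨U, hU, ht, ?_⟩
    -- In a frame `σ`, addition is `σ⁻¹ (σ x + σ y)`, which moves the question to the smooth
    -- addition of `V`.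
    have key : ∀ s : U, ((⟨(p s.1).1.1, (p s.1).2⟩ + ⟨(p s.1).1.2, rfl⟩ :
        Fiber X.proj (X.proj (p s.1).1.2)) : X.E) =
        (σ s).point ((σ s).eval _ (hσp' s) + (σ s).eval _ (hσp s)) := fun s => by
      refine Eq.trans ?_ (congrArg Subtype.val (((σ s).isLinearMap_point (hσp s)).map_add _ _)).symm
      congr 2 <;> exact Subtype.ext (point_eval _ _ _).symm
    refine (congrArg DSmooth (funext key)).mpr ?_
    exact dsmooth_point.comp (dsmooth_mk hσ (DiffeologicalVectorSpace.smooth_add.comp (dsmooth_mk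
      (dsmooth_eval_comp hσ (hx.comp (dsmooth_val _)) hσp')
      (dsmooth_eval_comp hσ (hy.comp (dsmooth_val _)) hσp))))
  smooth_smul := dsmooth_of_locally fun n p hp t => by
    have hy : DSmooth (fun t => (p t).2) := dsmooth_snd.comp hp
    obtain ⟨U, hU, ht, σ, hσ, hσp⟩ := h n _ (X.smooth_proj.comp hy) t
    refine ⟨U, hU, ht, ?_⟩
    have key : ∀ s : U, (((p s.1).1 • ⟨(p s.1).2, rfl⟩ :
        Fiber X.proj (X.proj (p s.1).2)) : X.E) =
        (σ s).point ((p s.1).1 • (σ s).eval _ (hσp s)) := fun s => by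
      refine Eq.trans ?_ (congrArg Subtype.val (((σ s).isLinearMap_point (hσp s)).map_smul _ _)).symm
      congr 2
      exact Subtype.ext (point_eval _ _ _).symm
    refine (congrArg DSmooth (funext key)).mpr ?_
    exact dsmooth_point.comp (dsmooth_mk hσ (DiffeologicalVectorSpace.smooth_smul.comp (dsmooth_mk
      (dsmooth_fst.comp (hp.comp (dsmooth_val _)))
      (dsmooth_eval_comp hσ (hy.comp (dsmooth_val _)) hσp))))
  smooth_zero := dsmooth_of_locally fun n p hp t => by
    obtain ⟨U, hU, ht, σ, hσ, hσp⟩ := h n _ hp t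
    refine ⟨U, hU, ht, ?_⟩
    have key : ∀ s : U, ((0 : Fiber X.proj (p s.1)) : X.E) = (σ s).point 0 := fun s =>
      (congrArg Subtype.val (((σ s).isLinearMap_point (hσp s)).map_zero)).symm
    refine (congrArg DSmooth (funext key)).mpr ?_
    exact dsmooth_point.comp (dsmooth_mk hσ dSmooth_const)

/-! ### Points, coordinates and frames of the associated bundle. -/

section Assoc

variable (P : PrincipalBundle (GLin V) B)

/-- The point `[y, v]` of the associated bundle. -/
def assocMk (y : P.1.E) (v : V) : (assoc P).E := Quotient.mk (assocSetoid P.1) (y, v)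

lemma assocMk_act (y : P.1.E) (g : GLin V) (v : V) :
    assocMk P (P.1.act y g) v = assocMk P y (g.1 v) :=
  (Quotient.sound (s := assocSetoid P.1) (a := (y, g.1 v)) (b := (P.1.act y g, v))
    ⟨g, Prod.ext rfl (g.1.toEquiv.symm_apply_apply v).symm⟩).symm

lemma assocMk_surjective (z : (assoc P).E) : ∃ y v, assocMk P y v = z := by
  obtain ⟨⟨y, v⟩, h⟩ := Quotient.exists_rep z
  exact ⟨y, v, h⟩

lemma dsmooth_assocMk : DSmooth (fun z : P.1.E × V => assocMk P z.1 z.2) :=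
  dsmooth_quotient_mk _

lemma assoc_exists_lift {n : ℕ} {p : Cart n → (assoc P).E} (hp : DSmooth p) (t : Cart n) :
    ∃ U : Set (Cart n), IsOpen U ∧ t ∈ U ∧ ∃ (y : U → P.1.E) (v : U → V), DSmooth y ∧ DSmooth v ∧
      ∀ s, assocMk P (y s) (v s) = p s.1 := by
  obtain ⟨U, hU, ht, q, hq, hqp⟩ := exists_lift_of_dsmooth (s := assocSetoid P.1) hp t
  exact ⟨U, hU, ht, fun s => (q s).1, fun s => (q s).2, dsmooth_fst.comp hq, dsmooth_snd.comp hq,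
    hqp⟩

variable {P} in
-- This is the universal property of the quotient diffeology: plots of the quotient lift locally to
-- pairs `(y, v)`.
lemma dsmooth_of_comp_assocMk {Y : Type w} [DiffeologicalSpace Y] {F : (assoc P).E → Y}
    (h : DSmooth (fun z : P.1.E × V => F (assocMk P z.1 z.2))) : DSmooth F :=
  dsmooth_of_locally fun n p hp t => by
    obtain ⟨U, hU, ht, y, v, hy, hv, hyv⟩ := assoc_exists_lift P hp t
    refine ⟨U, hU, ht, ?_⟩
    have key : (fun s : U => F (p s.1)) = fun s => F (assocMk P (y s) (v s)) :=
      funext fun s => congrArg F (hyv s).symm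
    rw [key]
    exact h.comp (dsmooth_mk hy hv)

lemma isLinearMap_assocMk {y : P.1.E} {b : B} (h : P.1.proj y = b) :
    IsLinearMap ℝ (fun v => (⟨assocMk P y v, h⟩ : Fiber (assoc P).proj b)) :=
  assocFrame_isLinearMap P ⟨y, h⟩

lemma exists_assocMk_eq {y : P.1.E} (z : (assoc P).E) (h : P.1.proj y = (assoc P).proj z) :
    ∃ v, assocMk P y v = z := by
  obtain ⟨v, hv⟩ := (assocFiberMap_bijective P.1 P.2 ⟨y, h⟩).2 ⟨z, rfl⟩
  exact ⟨v, congrArg Subtype.val hv⟩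

lemma assocMk_injective (y : P.1.E) : Function.Injective (assocMk P y) := fun _ _ h =>
  (assocFiberMap_bijective P.1 P.2 ⟨y, rfl⟩).1 (Subtype.ext h)

variable {P} in
/-- Linearity on a fiber of the associated bundle may be tested in a frame. -/
lemma isLinearMap_of_comp_assocMk {M : Type w} [AddCommGroup M] [Module ℝ M] {y : P.1.E} {b : B}
    (h : P.1.proj y = b) {F : Fiber (assoc P).proj b → M}
    (hF : IsLinearMap ℝ (fun v => F ⟨assocMk P y v, h⟩)) : IsLinearMap ℝ F := by
  have hl := isLinearMap_assocMk P h
  have hs : ∀ z : Fiber (assoc P).proj b, ∃ v, (⟨assocMk P y v, h⟩ : Fiber (assoc P).proj b) = z :=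
    fun z => (exists_assocMk_eq P z.1 (h.trans z.2.symm)).imp fun _ hv => Subtype.ext hv
  constructor
  · intro z z'
    obtain ⟨v, rfl⟩ := hs z
    obtain ⟨v', rfl⟩ := hs z'
    exact (congrArg F (hl.map_add v v')).symm.trans (hF.map_add v v')
  · intro c z
    obtain ⟨v, rfl⟩ := hs z
    exact (congrArg F (hl.map_smul c v)).symm.trans (hF.map_smul c v)

/-- The coordinate `v` of a point `[y, v]` in the frame `y`. -/
noncomputable def assocCoord (y : P.1.E) (z : (assoc P).E)
    (h : P.1.proj y = (assoc P).proj z) : V :=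
  (exists_assocMk_eq P z h).choose

lemma assocMk_assocCoord (y : P.1.E) (z : (assoc P).E) (h : P.1.proj y = (assoc P).proj z) :
    assocMk P y (assocCoord P y z h) = z :=
  (exists_assocMk_eq P z h).choose_spec

lemma assocCoord_assocMk (y : P.1.E) (v : V) :
    assocCoord P y (assocMk P y v) rfl = v :=
  assocMk_injective P y (assocMk_assocCoord P y _ _)

/-- Write `z` locally as `[y', v']` by a smooth lift. If `y' = y · g`, then `z = [y, g v']`, so the
coordinate in the frame `y` is `g v'`, where `g` is the smooth quotient of `y'` by `y`. -/
lemma dsmooth_assocCoord :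
    DSmooth (fun w : {w : P.1.E × (assoc P).E // P.1.proj w.1 = (assoc P).proj w.2} =>
      assocCoord P w.1.1 w.1.2 w.2) :=
  dsmooth_of_locally fun n p hp t => by
    have hx : DSmooth (fun t => (p t).1.1) := dsmooth_fst.comp ((dsmooth_val _).comp hp)
    have hz : DSmooth (fun t => (p t).1.2) := dsmooth_snd.comp ((dsmooth_val _).comp hp)
    obtain ⟨δ, hδ, h1, -⟩ := P.2.hasSmoothDivision
    obtain ⟨U, hU, ht, y, v, hy, hv, hyv⟩ := assoc_exists_lift P hz t
    have hxy : ∀ s : U, P.1.proj (p s.1).1.1 = P.1.proj (y s) := fun s =>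
      (p s.1).2.trans (congrArg (assoc P).proj (hyv s)).symm
    refine ⟨U, hU, ht, ?_⟩
    have key : ∀ s : U, assocCoord P (p s.1).1.1 (p s.1).1.2 (p s.1).2 =
        (δ ⟨((p s.1).1.1, y s), hxy s⟩).1 (v s) := fun s => by
      refine assocMk_injective P (p s.1).1.1 ((assocMk_assocCoord P _ _ _).trans ?_)
      rw [← assocMk_act, h1 ⟨((p s.1).1.1, y s), hxy s⟩]
      exact (hyv s).symm
    refine (congrArg DSmooth (funext key)).mpr ?_
    exact GLin.dsmooth_apply.comp (dsmooth_mk (hδ.comp (dsmooth_subtype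
      (dsmooth_mk (hx.comp (dsmooth_val _)) hy))) hv)

lemma dsmooth_assocCoord_comp {Y : Type w} [DiffeologicalSpace Y] {y : Y → P.1.E}
    {z : Y → (assoc P).E} (hy : DSmooth y) (hz : DSmooth z)
    (h : ∀ t, P.1.proj (y t) = (assoc P).proj (z t)) :
    DSmooth (fun t => assocCoord P (y t) (z t) (h t)) :=
  (dsmooth_assocCoord P).comp (f := fun t => (⟨(y t, z t), h t⟩ :
    {w : P.1.E × (assoc P).E // P.1.proj w.1 = (assoc P).proj w.2}))
    (dsmooth_subtype (dsmooth_mk hy hz))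

/-- The frame of the associated bundle defined by a point of the principal bundle; it is inverse to
`v ↦ [y, v]`. -/
noncomputable def assocLinearFrame (y : P.1.E) : LinearFrames V (assoc P) :=
  ofMaps (P.1.proj y) (fun x => assocCoord P y x.1 x.2.symm) (fun v => ⟨assocMk P y v, rfl⟩)
    (fun x => Subtype.ext (assocMk_assocCoord P y x.1 x.2.symm)) (assocCoord_assocMk P y)
    (dsmooth_assocCoord_comp P dSmooth_const (dsmooth_val _)
      (fun x : Fiber (assoc P).proj (P.1.proj y) => x.2.symm))
    (dsmooth_subtype ((dsmooth_assocMk P).comp (dsmooth_mk dSmooth_const dSmooth_id)))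
    (isLinearMap_of_comp_assocMk rfl (by
      simp only [assocCoord_assocMk]
      exact LinearMap.id.isLinear))

lemma dsmooth_assocLinearFrame : DSmooth (assocLinearFrame P) :=
  LinearFrames.dsmooth_of P.1.smooth_proj
    (dsmooth_assocCoord_comp P (dsmooth_fst.comp (dsmooth_val _))
      (dsmooth_snd.comp (dsmooth_val _)) fun z : {z : P.1.E × (assoc P).E //
        (assocLinearFrame P z.1).1.1 = (assoc P).proj z.2} => z.2)
    (dsmooth_assocMk P)

/-- Tested on inverse frames, this is the identity `[y · g, v] = [y, g v]`. -/
lemma assocLinearFrame_act (y : P.1.E) (g : GLin V) :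
    assocLinearFrame P (P.1.act y g) = (frame V (assoc P)).act (assocLinearFrame P y) g :=
  ext_point (P.1.proj_act y g) fun v => assocMk_act P y g v

/-! ### Triviality of associated bundles and comparison with frame bundles. -/

variable {P}

/-- A trivialization gives a section of `P` along `f`, and `assocLinearFrame` turns it into a family
of frames. -/
lemma GSpace.IsTrivial.assoc {B' : Type w'} [DiffeologicalSpace B'] {f : B' → B} {hf : DSmooth f}
    (h : (P.1.pullback f hf).IsTrivial) : ((assoc P).pullback f hf).IsTrivial V := by
  obtain ⟨σ, hσ, hσf⟩ := h.exists_section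
  exact VectorFamily.isTrivial_pullback_of_frame hf ((dsmooth_assocLinearFrame P).comp hσ) hσf

lemma GSpace.IsNumerable.assoc (h : P.1.IsNumerable) : (assoc P).IsNumerable V :=
  NumerablyTrivial.mono h fun _ hU => GSpace.IsTrivial.assoc hU

variable (P) in
lemma assoc_isVectorBundle [DiffeologicalVectorSpace V] : (assoc P).IsVectorBundle V where
  isDVS := VectorFamily.isDiffeologicalVectorSpace_of_frames fun n p hp t => by
    obtain ⟨U, hU, ht, hT⟩ := P.2.isTrivial_nhds hp t
    obtain ⟨σ, hσ, hσp⟩ := hT.exists_section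
    exact ⟨U, hU, ht, fun s => assocLinearFrame P (σ s), (dsmooth_assocLinearFrame P).comp hσ, hσp⟩
  locallyTrivial n U hU p hp := (P.2 n U hU p hp).mono fun _ hW =>
    VectorFamily.IsTrivial.restrict_of_pullback
      (GSpace.IsTrivial.pullback_of_restrict (P := P.1) hW).assoc

/-- A principal bundle is the frame bundle of its associated bundle. -/
lemma isomorphic_frame_assoc [DiffeologicalVectorSpace V] (P : PrincipalBundle (GLin V) B) :
    P.1.Isomorphic (frame V (assoc P)) :=
  P.2.isomorphic_of_equivariant (assoc_isVectorBundle P).frame (dsmooth_assocLinearFrame P)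
    (fun _ => rfl) (assocLinearFrame_act P)

/-- A smooth bijection from an associated bundle over the base, along which smooth families
locally lift and which is linear in frames, is an isomorphism. -/
lemma assoc_isomorphic_of {X : VectorFamily.{u, u} B} (F : (assoc P).E → X.E)
    (hF : Function.Bijective F) (hproj : ∀ y v, X.proj (F (assocMk P y v)) = P.1.proj y)
    (hs : DSmooth (fun z : P.1.E × V => F (assocMk P z.1 z.2)))
    (hl : ∀ y, IsLinearMap ℝ (fun v => (⟨F (assocMk P y v), hproj y v⟩ :
      Fiber X.proj (P.1.proj y))))
    (hlift : ∀ (n : ℕ) (q : Cart n → X.E), DSmooth q → ∀ t, ∃ U : Set (Cart n), IsOpen U ∧ t ∈ U ∧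
      ∃ (y : U → P.1.E) (v : U → V), DSmooth y ∧ DSmooth v ∧
        ∀ s, F (assocMk P (y s) (v s)) = q s.1) : (assoc P).Isomorphic X := by
  refine ⟨⟨Equiv.ofBijective F hF, dsmooth_of_comp_assocMk hs,
    dsmooth_symm_of_locally_lift _ fun n q hq t => ?_⟩, fun z => ?_, fun b => ?_⟩
  · obtain ⟨U, hU, ht, y, v, hy, hv, hyv⟩ := hlift n q hq t
    exact ⟨U, hU, ht, fun s => assocMk P (y s) (v s),
      (dsmooth_assocMk P).comp (dsmooth_mk hy hv), hyv⟩
  · obtain ⟨y, v, rfl⟩ := assocMk_surjective P z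
    exact hproj y v
  · obtain ⟨y, rfl⟩ := P.2.exists_point b
    exact isLinearMap_of_comp_assocMk rfl (hl y)

/-- Isomorphic principal bundles have isomorphic associated bundles. -/
lemma GSpace.Isomorphic.assoc {P Q : PrincipalBundle (GLin V) B} (h : P.1.Isomorphic Q.1) :
    (assoc P).Isomorphic (assoc Q) := by
  obtain ⟨k, k1, k2⟩ := h
  have hr : ∀ y, k (k.symm y) = y := k.toEquiv.apply_symm_apply
  let F : (DiffBundle.assoc P).E → (DiffBundle.assoc Q).E :=
    -- Well defined: `[k (y · g), g⁻¹ v] = [k y · g, g⁻¹ v] = [k y, v]`.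
    Quotient.lift (fun a : P.1.E × V => assocMk Q (k a.1) a.2) (by
      rintro a b ⟨g, rfl⟩
      change _ = assocMk Q (k (P.1.act a.1 g)) _
      rw [k2, assocMk_act]
      exact congrArg _ (g.1.toEquiv.apply_symm_apply a.2).symm)
  have hF : ∀ y v, F (assocMk P y v) = assocMk Q (k y) v := fun _ _ => rfl
  refine assoc_isomorphic_of F ⟨fun z z' hzz => ?_, fun z => ?_⟩ (fun y _ => k1 y)
    ((dsmooth_assocMk Q).comp (dsmooth_mk (k.smooth_toFun.comp dsmooth_fst) dsmooth_snd))
    (fun y => isLinearMap_assocMk Q (k1 y)) fun n q hq t => ?_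
  · obtain ⟨y, v, rfl⟩ := assocMk_surjective P z
    obtain ⟨y', v', rfl⟩ := assocMk_surjective P z'
    have hyy : P.1.proj y = P.1.proj y' :=
      (k1 y).symm.trans ((congrArg (DiffBundle.assoc Q).proj hzz).trans (k1 y'))
    -- Points over the same base point can be written with the same `y` by absorbing `g` into the
    -- vector; injectivity of `v ↦ [k y, v]` then finishes.
    obtain ⟨g, rfl⟩ := P.2.exists_act hyy
    rw [assocMk_act] at hzz ⊢
    exact congrArg _ (assocMk_injective Q (k y) hzz)
  · obtain ⟨y, v, rfl⟩ := assocMk_surjective Q z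
    exact ⟨assocMk P (k.symm y) v, (hF _ _).trans (congrArg (fun y => assocMk Q y v) (hr y))⟩
  · obtain ⟨U, hU, ht, y, v, hy, hv, hyv⟩ := assoc_exists_lift Q hq t
    exact ⟨U, hU, ht, fun s => k.symm (y s), v, k.smooth_invFun.comp hy, hv, fun s =>
      (congrArg (fun y => assocMk Q y (v s)) (hr (y s))).trans (hyv s)⟩

/-- Forming the associated bundle commutes with pullback. -/
lemma assoc_pullback (P : PrincipalBundle (GLin V) B) {B' : Type u} [DiffeologicalSpace B']
    (f : B' → B) (hf : DSmooth f) :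
    (assoc (⟨P.1.pullback f hf, P.2.pullback f hf⟩ : PrincipalBundle (GLin V) B')).Isomorphic
      ((assoc P).pullback f hf) := by
  let P' : PrincipalBundle (GLin V) B' := ⟨P.1.pullback f hf, P.2.pullback f hf⟩
  let F : (assoc P').E → ((assoc P).pullback f hf).E :=
    Quotient.lift (fun a : P'.1.E × V => ⟨(a.1.1.1, assocMk P a.1.1.2 a.2), a.1.2⟩) (by
      rintro a b ⟨g, rfl⟩
      refine Subtype.ext (Prod.ext rfl ?_)
      change _ = assocMk P (P.1.act a.1.1.2 g) _
      rw [assocMk_act]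
      exact congrArg (assocMk P a.1.1.2) (g.1.toEquiv.apply_symm_apply a.2).symm)
  refine assoc_isomorphic_of F ⟨fun z z' hzz => ?_, fun z => ?_⟩ (fun y _ => rfl) ?_
    (fun y => ?_) fun n q hq t => ?_
  · obtain ⟨y, v, rfl⟩ := assocMk_surjective P' z
    obtain ⟨y', v', rfl⟩ := assocMk_surjective P' z'
    have hyy : P'.1.proj y = P'.1.proj y' := congrArg ((assoc P).pullback f hf).proj hzz
    obtain ⟨g, rfl⟩ := P'.2.exists_act hyy
    rw [assocMk_act] at hzz ⊢
    exact congrArg _ (assocMk_injective P y.1.2 (congrArg (fun z => z.1.2) hzz))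
  · obtain ⟨⟨b, w⟩, hz⟩ := z
    obtain ⟨y, v, rfl⟩ := assocMk_surjective P w
    exact ⟨assocMk P' ⟨(b, y), hz⟩ v, rfl⟩
  · exact dsmooth_subtype (dsmooth_mk (dsmooth_fst.comp ((dsmooth_val _).comp dsmooth_fst))
      ((dsmooth_assocMk P).comp (dsmooth_mk
        (dsmooth_snd.comp ((dsmooth_val _).comp dsmooth_fst)) dsmooth_snd)))
  -- The fiber of the pullback carries the structure transported from the fiber of `assoc P`, where
  -- `v ↦ [y, v]` is linear.
  · exact ((VectorFamily.isLinearMap_pullbackFiber_symm f hf (assoc P) y.1.1).mk' _ ∘ₗ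
      (isLinearMap_assocMk P y.2.symm).mk' _).isLinear
  · have hb : DSmooth (fun t => (q t).1.1) := dsmooth_fst.comp ((dsmooth_val _).comp hq)
    have hw : DSmooth (fun t => (q t).1.2) := dsmooth_snd.comp ((dsmooth_val _).comp hq)
    -- Only the component in `assoc P` needs lifting; the base component is reattached to the lifted
    -- `y`.
    obtain ⟨U, hU, ht, y, v, hy, hv, hyv⟩ := assoc_exists_lift P hw t
    refine ⟨U, hU, ht, fun s => ⟨((q s.1).1.1, y s),
      (q s.1).2.trans (congrArg (assoc P).proj (hyv s)).symm⟩, v,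
      dsmooth_subtype (dsmooth_mk (hb.comp (dsmooth_val _)) hy), hv, fun s => ?_⟩
    exact Subtype.ext (Prod.ext rfl (hyv s))

/-- A vector bundle is associated to its frame bundle. -/
lemma assoc_frame_isomorphic {X : VectorFamily.{u, u} B} (hX : X.IsVectorBundle V) :
    (assoc (⟨frame V X, hX.frame⟩ : PrincipalBundle (GLin V) B)).Isomorphic X := by
  let P : PrincipalBundle (GLin V) B := ⟨frame V X, hX.frame⟩
  let F : (assoc P).E → X.E :=
    -- The map is `[f, v] ↦ f⁻¹ v`, well defined since `(f · g)⁻¹ = f⁻¹ ∘ g`.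
    Quotient.lift (fun a : LinearFrames V X × V => a.1.point a.2) (by
      rintro a b ⟨g, rfl⟩
      exact congrArg a.1.point (g.1.toEquiv.apply_symm_apply a.2).symm)
  refine assoc_isomorphic_of F ⟨fun z z' hzz => ?_, fun z => ?_⟩
    (fun y v => LinearFrames.proj_point y v) dsmooth_point
    (fun y => LinearFrames.isLinearMap_point y rfl) fun n q hq t => ?_
  · obtain ⟨y, v, rfl⟩ := assocMk_surjective P z
    obtain ⟨y', v', rfl⟩ := assocMk_surjective P z'
    have hyy : P.1.proj y = P.1.proj y' :=
      (LinearFrames.proj_point y v).symm.trans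
        ((congrArg X.proj hzz).trans (LinearFrames.proj_point y' v'))
    obtain ⟨g, rfl⟩ := P.2.exists_act hyy
    rw [assocMk_act] at hzz ⊢
    have hinj : Function.Injective (LinearFrames.point y) :=
      Subtype.val_injective.comp y.1.2.toEquiv.symm.injective
    exact congrArg _ (hinj hzz)
  · obtain ⟨y, hy⟩ := P.2.exists_point (X.proj z)
    exact ⟨assocMk P y (LinearFrames.eval y z hy), LinearFrames.point_eval y z hy⟩
  -- A smooth local frame `σ` below `q` gives the lift `[σ, σ q]` of `q`.
  · obtain ⟨U, hU, ht, hT⟩ := P.2.isTrivial_nhds (X.smooth_proj.comp hq) t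
    obtain ⟨σ, hσ, hσq⟩ := hT.exists_section
    exact ⟨U, hU, ht, σ, fun s => LinearFrames.eval (σ s) (q s.1) (hσq s), hσ,
      dsmooth_eval_comp hσ (hq.comp (dsmooth_val _)) hσq,
      fun s => LinearFrames.point_eval (σ s) (q s.1) (hσq s)⟩

end Assoc

end DiffBundle

namespace DiffBundle

/-! ### The isomorphism of functors -/

section Functors

variable (V : Type u) [AddCommGroup V] [Module ℝ V] [DiffeologicalSpace V]
  [DiffeologicalVectorSpace V]

/-- The associated bundle, on isomorphism classes. -/
noncomputable def assocClass (B : Type u) [DiffeologicalSpace B] :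
    Quotient (principalSetoid (GLin V) B) → Quotient (vectorSetoid V B) :=
  Quotient.map (fun P => ⟨assoc P, assoc_isVectorBundle P⟩) fun _ _ h => GSpace.Isomorphic.assoc h

/-- The frame bundle, on isomorphism classes. -/
def frameClass (B : Type u) [DiffeologicalSpace B] :
    Quotient (vectorSetoid V B) → Quotient (principalSetoid (GLin V) B) :=
  Quotient.map (fun X => ⟨frame V X.1, X.2.frame⟩) fun X Y h =>
    VectorFamily.Isomorphic.frame h X.2 Y.2

/-- `Prin_{GL(V)} ≅ VB_V`. -/
noncomputable def prinIsoVB : Prin.{u} (GLin V) ≅ VB.{u} V :=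
  NatIso.ofComponents
    (fun B =>
      { hom := TypeCat.ofHom (assocClass V B.unop)
        inv := TypeCat.ofHom (frameClass V B.unop)
        hom_inv_id := by
          ext x
          induction x using Quotient.inductionOn with
          | h P => exact Quotient.sound (isomorphic_frame_assoc P).symm
        inv_hom_id := by
          ext x
          induction x using Quotient.inductionOn with
          | h X => exact Quotient.sound (assoc_frame_isomorphic X.2) })
    (fun f => by
      ext x
      induction x using Quotient.inductionOn with
      | h P => exact Quotient.sound (assoc_pullback P f.unop.1 f.unop.2))

/-- A numerable class is one with a numerable representative, and the associated bundle of that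
representative is numerable. -/
lemma range_prinIsoVB_hom_le :
    Subfunctor.range ((PrinD.{u} (GLin V)).ι ≫ (prinIsoVB V).hom) ≤ VBD.{u} V := fun _ y hy => by
  obtain ⟨⟨_, P, rfl, hP⟩, rfl⟩ : y ∈ Set.range _ := hy
  exact ⟨⟨assoc P, assoc_isVectorBundle P⟩, rfl, GSpace.IsNumerable.assoc hP⟩

lemma range_prinIsoVB_inv_le :
    Subfunctor.range ((VBD.{u} V).ι ≫ (prinIsoVB V).inv) ≤ PrinD.{u} (GLin V) := fun _ y hy => by
  obtain ⟨⟨_, X, rfl, hX⟩, rfl⟩ : y ∈ Set.range _ := hy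
  exact ⟨⟨frame V X.1, X.2.frame⟩, rfl, hX.frame⟩

/-- `Prin_{GL(V)}^D ≅ VB_V^D`. -/
noncomputable def prinDIsoVBD :
    (PrinD.{u} (GLin V)).toFunctor ≅ (VBD.{u} V).toFunctor where
  hom := Subfunctor.lift _ (range_prinIsoVB_hom_le V)
  inv := Subfunctor.lift _ (range_prinIsoVB_inv_le V)
  hom_inv_id := by
    -- The inclusion of a subfunctor is a monomorphism, so the identity may be checked in the
    -- ambient functor, where it is that of `prinIsoVB`.
    rw [← cancel_mono (PrinD.{u} (GLin V)).ι, Category.assoc, Subfunctor.lift_ι,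
      ← Category.assoc, Subfunctor.lift_ι, Category.assoc, Iso.hom_inv_id, Category.comp_id,
      Category.id_comp]
  inv_hom_id := by
    rw [← cancel_mono (VBD.{u} V).ι, Category.assoc, Subfunctor.lift_ι,
      ← Category.assoc, Subfunctor.lift_ι, Category.assoc, Iso.inv_hom_id, Category.comp_id,
      Category.id_comp]

end Functors

end DiffBundle

theorem mainTheorem9 (V : Type u) [AddCommGroup V] [Module ℝ V] [DiffeologicalSpace V]
    [DiffBundle.DiffeologicalVectorSpace V] :
    ∃ α : DiffBundle.Prin.{u} (DiffBundle.GLin V) ≅ DiffBundle.VB.{u} V,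
      (∀ (B : DiffBundle.DiffSp.{u}) (P : DiffBundle.PrincipalBundle (DiffBundle.GLin V) B),
        ∃ h : (DiffBundle.assoc P).IsVectorBundle V,
          α.hom.app (op B) (Quotient.mk (DiffBundle.principalSetoid (DiffBundle.GLin V) B) P) =
            Quotient.mk (DiffBundle.vectorSetoid V B) ⟨DiffBundle.assoc P, h⟩) ∧
      (∀ (B : DiffBundle.DiffSp.{u}) (X : DiffBundle.VectorBundle V B),
        ∃ h : (DiffBundle.frame V X.1).IsPrincipal,
          α.inv.app (op B) (Quotient.mk (DiffBundle.vectorSetoid V B) X) =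
            Quotient.mk (DiffBundle.principalSetoid (DiffBundle.GLin V) B)
              ⟨DiffBundle.frame V X.1, h⟩) ∧
      ∃ αD : (DiffBundle.PrinD.{u} (DiffBundle.GLin V)).toFunctor ≅ (DiffBundle.VBD.{u} V).toFunctor,
        αD.hom ≫ (DiffBundle.VBD.{u} V).ι =
            (DiffBundle.PrinD.{u} (DiffBundle.GLin V)).ι ≫ α.hom ∧
          αD.inv ≫ (DiffBundle.PrinD.{u} (DiffBundle.GLin V)).ι =
            (DiffBundle.VBD.{u} V).ι ≫ α.inv := by
  -- The formulas on classes hold by `rfl` because the components are `Quotient.map`s of the two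
  -- constructions.
  refine ⟨DiffBundle.prinIsoVB V, fun _ P => ⟨DiffBundle.assoc_isVectorBundle P, rfl⟩,
    fun _ X => ⟨X.2.frame, rfl⟩, DiffBundle.prinDIsoVBD V, ?_, ?_⟩
  · exact Subfunctor.lift_ι _ (DiffBundle.range_prinIsoVB_hom_le V)
  · exact Subfunctor.lift_ι _ (DiffBundle.range_prinIsoVB_inv_le V)
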